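/- Let $n \ge 1$, let $\mathbb{B}_n$ be the open unit ball of $\mathbb{C}^n$, and let $dv$ be Lebesgue measure on $\mathbb{B}_n$ normalized by $v(\mathbb{B}_n)=1$. For $1<p<\infty$ let $A^p$ be the Bergman space of all holomorphic functions $f$ on $\mathbb{B}_n$ with $\|f\|_{A^p}^p=\int_{\mathbb{B}_n}|f|^p\,dv<\infty$, let $p'$ be given by $\frac1p+\frac1{p'}=1$, and write $\langle f,g\rangle_{A^2}=\int_{\mathbb{B}_n} f\,\overline{g}\,dv$ for $f\in A^p$, $g\in A^{p'}$. For $z,w\in\mathbb{B}_n$ write $\overline{z}w=\sum_i \overline{z_i}w_i$ and put $$K_z(w)=\frac{1}{(1-\overline{z}w)^{n+1}},\qquad k_z=(1-|z|^2)^{\frac{n+1}{2}}K_z,\qquad k_z^{(p)}=\frac{K_z}{\|K_z\|_{A^2}^{2/p'}},\qquad k_z^{(p')}=\frac{K_z}{\|K_z\|_{A^2}^{2/p}}.$$ Let $\varphi_z$ be the Möbius involution of $\mathbb{B}_n$ that interchanges $0$ and $z$, that is, $$\varphi_z(w)=\frac{z-P_zw-(1-|z|^2)^{1/2}(w-P_zw)}{1-\overline{z}w},$$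 where $P_z$ is the orthogonal projection of $\mathbb{C}^n$ onto the linear span of $z$. Let $\rho(z,w)=|\varphi_z(w)|$, $\beta(z,w)=\frac12\log\frac{1+\rho(z,w)}{1-\rho(z,w)}$ and $D(z,r)=\{w\in\mathbb{B}_n:\beta(z,w)\le r\}$. If $T$ is any bounded linear operator on $A^p$, $1<p<\infty$, then the following are equivalent: (a) $\lim_{|z|\to1^-}\sup_{w\in D(z,r)}|\langle Tk_z^{(p)},k_w^{(p')}\rangle_{A^2}|=0$ for all $r>0$; (b) $\lim_{|z|\to1^-}\sup_{w\in D(z,r)}|\langle Tk_z^{(p)},k_w^{(p')}\rangle_{A^2}|=0$ for some $r>0$; (c) $\lim_{|z|\to1^-}|\langle Tk_z,k_z\rangle_{A^2}|=0$. -/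

import Mathlib

open MeasureTheory Filter Topology
open scoped ENNReal ComplexConjugate

noncomputable section

namespace Bergman

/-- The space `ℂⁿ` with its Euclidean (Hermitian) norm. -/
abbrev Cn (n : ℕ) : Type := EuclideanSpace ℂ (Fin n)

/-- The open unit ball of `ℂⁿ`, as a set. -/
abbrev unitBall (n : ℕ) : Set (Cn n) := Metric.ball (0 : Cn n) 1

/-- Lebesgue measure on the unit ball of `ℂⁿ`, normalized to have total mass one. -/
def ballMeasure (n : ℕ) : Measure (Cn n) :=
  (volume (unitBall n))⁻¹ • volume.restrict (unitBall n)

/-- The Bergman space `A^p`: the (classes of) functions in `L^p` of the normalized Lebesgue measure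
on the unit ball which are holomorphic there, with the norm of `L^p`. -/
def Ap (n : ℕ) (p : ℝ≥0∞) : Submodule ℂ (Lp ℂ p (ballMeasure n)) where
  carrier := {f | ∃ g : Cn n → ℂ, DifferentiableOn ℂ g (unitBall n) ∧ f =ᵐ[ballMeasure n] g}
  add_mem' := by
    rintro f₁ f₂ ⟨g₁, h₁, e₁⟩ ⟨g₂, h₂, e₂⟩
    exact ⟨g₁ + g₂, h₁.add h₂, (Lp.coeFn_add f₁ f₂).trans (e₁.add e₂)⟩
  zero_mem' := ⟨0, differentiableOn_const 0, Lp.coeFn_zero ℂ p (ballMeasure n)⟩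
  smul_mem' := by
    rintro c f ⟨g, h, e⟩
    exact ⟨c • g, h.const_smul c, (Lp.coeFn_smul c f).trans (e.const_smul c)⟩

/-- The pairing `⟨f, g⟩_{A²} = ∫ f \bar g dv` between `A^p` and `A^q` (used for conjugate
exponents, where the integrand is integrable by Hölder's inequality). -/
def pairing {n : ℕ} {p q : ℝ≥0∞} (f : Ap n p) (g : Ap n q) : ℂ :=
  ∫ x, (f : Lp ℂ p (ballMeasure n)) x * conj ((g : Lp ℂ q (ballMeasure n)) x) ∂(ballMeasure n)

/-- The Bergman kernel `K_z(w) = (1 - \bar z w)^{-(n+1)}`, where `\bar z w = ∑ \bar z_i w_i`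
(the inner product of Mathlib is conjugate-linear in its first argument). -/
def kernelFun {n : ℕ} (z w : Cn n) : ℂ := ((1 - inner ℂ z w) ^ (n + 1))⁻¹

theorem one_sub_norm_le {n : ℕ} (z : Cn n) {w : Cn n} (hw : w ∈ unitBall n) :
    1 - ‖z‖ ≤ ‖1 - inner ℂ z w‖ := by
  have h1 : ‖inner ℂ z w‖ ≤ ‖z‖ * ‖w‖ := norm_inner_le_norm z w
  have h2 : ‖w‖ ≤ 1 := (mem_ball_zero_iff.mp hw).le
  have h3 : ‖(1 : ℂ)‖ - ‖inner ℂ z w‖ ≤ ‖1 - inner ℂ z w‖ := norm_sub_norm_le _ _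
  have h4 : ‖z‖ * ‖w‖ ≤ ‖z‖ := mul_le_of_le_one_right (norm_nonneg z) h2
  rw [norm_one] at h3
  linarith

theorem kernelFun_differentiableOn {n : ℕ} (z : unitBall n) :
    DifferentiableOn ℂ (kernelFun (z : Cn n)) (unitBall n) := by
  have hz : ‖(z : Cn n)‖ < 1 := mem_ball_zero_iff.mp z.2
  have hd : Differentiable ℂ (fun w : Cn n => (1 - inner ℂ (z : Cn n) w) ^ (n + 1)) :=
    ((differentiable_const (1 : ℂ)).sub (innerSL ℂ (z : Cn n)).differentiable).pow (n + 1)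
  refine hd.differentiableOn.inv fun w hw => pow_ne_zero _ ?_
  have := one_sub_norm_le (z : Cn n) hw
  exact norm_pos_iff.mp (by linarith)

theorem kernelFun_memLp {n : ℕ} (p : ℝ≥0∞) (z : unitBall n) :
    MemLp (kernelFun (z : Cn n)) p (ballMeasure n) := by
  have hz : ‖(z : Cn n)‖ < 1 := mem_ball_zero_iff.mp z.2
  have hv : volume (unitBall n) ≠ 0 := (Metric.measure_ball_pos volume (0 : Cn n) one_pos).ne'
  have hfin : IsFiniteMeasure (volume.restrict (unitBall n)) :=
    ⟨by rw [Measure.restrict_apply_univ]; exact measure_ball_lt_top⟩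
  refine MemLp.smul_measure ?_ (ENNReal.inv_ne_top.mpr hv)
  refine MemLp.of_bound
    ((kernelFun_differentiableOn z).continuousOn.aestronglyMeasurable
      Metric.isOpen_ball.measurableSet)
    (((1 - ‖(z : Cn n)‖) ^ (n + 1))⁻¹) ?_
  filter_upwards [ae_restrict_mem Metric.isOpen_ball.measurableSet] with w hw
  have h0 : 0 < 1 - ‖(z : Cn n)‖ := by linarith
  have h1 := one_sub_norm_le (z : Cn n) hw
  rw [kernelFun, norm_inv, norm_pow]
  gcongr

/-- The Bergman kernel `K_z` as an element of `A^p`. -/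
def K {n : ℕ} (p : ℝ≥0∞) (z : unitBall n) : Ap n p :=
  ⟨(kernelFun_memLp p z).toLp _, kernelFun (z : Cn n), kernelFun_differentiableOn z,
    (kernelFun_memLp p z).coeFn_toLp⟩

/-- The normalized reproducing kernel `k_z = (1 - |z|²)^{(n+1)/2} K_z`, as an element of `A^p`. -/
def k {n : ℕ} (p : ℝ≥0∞) (z : unitBall n) : Ap n p :=
  (((1 - ‖(z : Cn n)‖ ^ 2) ^ (((n : ℝ) + 1) / 2) : ℝ) : ℂ) • K p z

/-- `kNorm p p' z` is the `p`-normalized reproducing kernel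
`k_z^{(p)} = K_z / ‖K_z‖_{A²}^{2/p'}` in `A^p`, where `p'` is the exponent conjugate to `p`. -/
def kNorm {n : ℕ} (p p' : ℝ≥0∞) (z : unitBall n) : Ap n p :=
  (((‖K 2 z‖ ^ (2 / p'.toReal))⁻¹ : ℝ) : ℂ) • K p z

/-- The Möbius involution `φ_z` of the unit ball that interchanges `0` and `z`:
`φ_z(w) = (z - P_z w - (1 - |z|²)^{1/2} (w - P_z w)) / (1 - \bar z w)` with `P_z` the orthogonal
projection onto the line `ℂ z` (and `P_0 = 0`). -/
def mobius {n : ℕ} (z w : Cn n) : Cn n :=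
  let Pw : Cn n := (ℂ ∙ z).starProjection w
  (1 - inner ℂ z w)⁻¹ • (z - Pw - ((Real.sqrt (1 - ‖z‖ ^ 2) : ℝ) : ℂ) • (w - Pw))

/-- The pseudohyperbolic metric `ρ(z, w) = |φ_z(w)|`. -/
def rho {n : ℕ} (z w : unitBall n) : ℝ := ‖mobius (z : Cn n) (w : Cn n)‖

/-- The Bergman metric `β(z, w) = ½ log ((1 + ρ(z, w)) / (1 - ρ(z, w)))`. -/
def beta {n : ℕ} (z w : unitBall n) : ℝ := 1 / 2 * Real.log ((1 + rho z w) / (1 - rho z w))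

/-- The closed hyperbolic disc `D(z, r) = {w : β(z, w) ≤ r}`. -/
def D {n : ℕ} (z : unitBall n) (r : ℝ) : Set (unitBall n) := {w | beta z w ≤ r}

/-- The filter on the unit ball describing `|z| → 1⁻`. -/
def toBoundary (n : ℕ) : Filter (unitBall n) :=
  comap (fun z : unitBall n => ‖(z : Cn n)‖) (𝓝[<] 1)

/-- `lim_{|z| → 1⁻} sup_{w ∈ D(z, r)} |⟨T k_z^{(p)}, k_w^{(p')}⟩| = 0`, the supremum being taken
in `[0, ∞]`. -/
def VanishesOnDiscs {n : ℕ} {p : ℝ≥0∞} [Fact (1 ≤ p)] (p' : ℝ≥0∞) (T : Ap n p →L[ℂ] Ap n p)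
    (r : ℝ) : Prop :=
  Tendsto (fun z : unitBall n => ⨆ w ∈ D z r, ‖pairing (T (kNorm p p' z)) (kNorm p' p w)‖ₑ)
    (toBoundary n) (𝓝 0)

end Bergman

end

/-! Since `z ∈ D(z,r)` and the exponents are conjugate, the entry `⟨T k_z^{(p)}, k_z^{(p')}⟩` has
the same modulus as the Berezin transform `⟨T k_z, k_z⟩`; so (a) ⇒ (b) ⇒ (c) is easy. The content is
(c) ⇒ (a): diagonal decay forces decay at bounded hyperbolic distance from the diagonal.

Recentre at `z`. By Möbius covariance (`kernelFun_mul_kernelFun_mobius`), `K_z · (K_a ∘ φ_z)` is a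
scalar multiple of the kernel at `φ_z(a)`. For `a = xu`, `b = yu` with `u` in the closed unit ball,
pairing `T` of the first function with the second and multiplying by `(1-|z|²)^{n+1}` gives a double
power series in `conj x` and `y` (`hasSum_kernelCoeff`). Three facts about it suffice.

Its coefficients are dominated uniformly in `z` and `u` (`exists_norm_kernelCoeff_le`). This rests
on the sharp growth of `‖K_z‖` in `A^p`: the Jacobian of `φ_z` gives the `L²` norm, Chebyshev turns
that into a uniform weak `L¹` bound, and the layer-cake formula gives every `p > 1`.

On `x = y` it is, up to a bounded factor, the Berezin transform at `φ_z(xu)`, which tends to 0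
uniformly for `|x| ≤ 1/2` (`eventually_norm_tsum_kernelCoeff_le`).

A double series is determined by its diagonal, quantitatively: Fourier coefficients on small circles
show that the coefficients of the pure powers `y^m` tend to 0 (`tendsto_coeff_zero`).

Setting `x = 0`, `y = t` leaves only these pure powers, and dominated convergence makes the sum tend
to 0 for each `t < 1`. This controls `⟨T K_z, K_w⟩` for all `w = φ_z(tu)`, which cover `D(z,r)` when
`t = tanh r`. -/

noncomputable section

namespace Bergman

variable {n : ℕ}

/-! ### Algebra of the Möbius involution -/

/-- The linear map `A_z = P_z + (1 - |z|²)^{1/2} (1 - P_z)` in the numerator of `φ_z`. -/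
def mobiusLin (z : Cn n) : Cn n →L[ℂ] Cn n :=
  (ℂ ∙ z).starProjection + ((Real.sqrt (1 - ‖z‖ ^ 2) : ℝ) : ℂ) •
    (ContinuousLinearMap.id ℂ (Cn n) - (ℂ ∙ z).starProjection)

theorem mobius_eq (z w : Cn n) :
    mobius z w = (1 - inner ℂ z w)⁻¹ • (z - mobiusLin z w) := by
  simp [mobius, mobiusLin, sub_sub]

theorem starProjection_span_self (z : Cn n) : (ℂ ∙ z).starProjection z = z :=
  Submodule.starProjection_eq_self_iff.mpr (Submodule.mem_span_singleton_self z)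

theorem norm_sq_smul_starProjection (z w : Cn n) :
    ((‖z‖ : ℂ) ^ 2) • (ℂ ∙ z).starProjection w = inner ℂ z w • z := by
  simpa using Submodule.smul_starProjection_singleton (𝕜 := ℂ) (v := z) w

theorem mobiusLin_self (z : Cn n) : mobiusLin z z = z := by
  simp [mobiusLin, starProjection_span_self]

theorem mobiusLin_symm (z a w : Cn n) : inner ℂ (mobiusLin z a) w = inner ℂ a (mobiusLin z w) := by
  have h := Submodule.inner_starProjection_left_eq_right (ℂ ∙ z) a w
  simp [mobiusLin, h]

theorem inner_self_mobiusLin (z w : Cn n) : inner ℂ z (mobiusLin z w) = inner ℂ z w := by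
  rw [← mobiusLin_symm, mobiusLin_self]

/-- With `s² = 1 - |z|²` and `P` idempotent, `A² = s² + (1 - s²)P`, and `|z|² P w = ⟨z,w⟩ z`. In
this form nothing is divided by `|z|²`, so `z = 0` needs no separate case. -/
theorem mobiusLin_mobiusLin {z : Cn n} (hz : ‖z‖ < 1) (w : Cn n) :
    mobiusLin z (mobiusLin z w) = (1 - (‖z‖ : ℂ) ^ 2) • w + inner ℂ z w • z := by
  have hs : ((Real.sqrt (1 - ‖z‖ ^ 2) : ℝ) : ℂ) ^ 2 = 1 - (‖z‖ : ℂ) ^ 2 := by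
    rw [← Complex.ofReal_pow, Real.sq_sqrt (by nlinarith [norm_nonneg z])]
    simp
  have hP : (ℂ ∙ z).starProjection ((ℂ ∙ z).starProjection w) = (ℂ ∙ z).starProjection w :=
    Submodule.starProjection_eq_self_iff.mpr (Submodule.starProjection_apply_mem _ _)
  rw [← norm_sq_smul_starProjection, ← hs]
  have h2 : ((‖z‖ : ℂ) ^ 2) = 1 - ((Real.sqrt (1 - ‖z‖ ^ 2) : ℝ) : ℂ) ^ 2 := by rw [hs]; ring
  rw [h2]
  simp only [mobiusLin, add_apply, smul_apply,
    sub_apply, ContinuousLinearMap.id_apply, map_add, map_sub, map_smul, hP]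
  module

theorem one_sub_inner_ne_zero {z w : Cn n} (hz : ‖z‖ < 1) (hw : ‖w‖ ≤ 1) :
    1 - inner ℂ z w ≠ 0 := by
  have h1 : ‖inner ℂ z w‖ ≤ ‖z‖ * ‖w‖ := norm_inner_le_norm z w
  intro h
  have : inner ℂ z w = 1 := (sub_eq_zero.mp h).symm
  rw [this, norm_one] at h1
  nlinarith [norm_nonneg z, norm_nonneg w]

/-- Expand `|z - A w|²`, using that `A` is self-adjoint, fixes `z`, and has the square computed
above. -/
theorem one_sub_norm_sq_mobius {z w : Cn n} (hz : ‖z‖ < 1) (hw : ‖w‖ < 1) :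
    1 - ‖mobius z w‖ ^ 2 = (1 - ‖z‖ ^ 2) * (1 - ‖w‖ ^ 2) / ‖1 - inner ℂ z w‖ ^ 2 := by
  have hd : ‖1 - inner ℂ z w‖ ≠ 0 := norm_ne_zero_iff.mpr (one_sub_inner_ne_zero hz hw.le)
  have hA : (‖mobiusLin z w‖ : ℂ) ^ 2 =
      (1 - (‖z‖ : ℂ) ^ 2) * (‖w‖ : ℂ) ^ 2 + inner ℂ z w * inner ℂ w z := by
    have := inner_self_eq_norm_sq_to_K (𝕜 := ℂ) (mobiusLin z w)
    rw [mobiusLin_symm, mobiusLin_mobiusLin hz, inner_add_right, inner_smul_right,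
      inner_smul_right] at this
    have hw2 := inner_self_eq_norm_sq_to_K (𝕜 := ℂ) w
    simp only [Complex.coe_algebraMap] at this hw2
    rw [← this, hw2]
  have hN : (‖z - mobiusLin z w‖ : ℂ) ^ 2 =
      (‖1 - inner ℂ z w‖ : ℂ) ^ 2 - (1 - (‖z‖ : ℂ) ^ 2) * (1 - (‖w‖ : ℂ) ^ 2) := by
    have h1 := inner_self_eq_norm_sq_to_K (𝕜 := ℂ) (z - mobiusLin z w)
    have h2 := inner_self_eq_norm_sq_to_K (𝕜 := ℂ) z
    have h3 := inner_self_eq_norm_sq_to_K (𝕜 := ℂ) (mobiusLin z w)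
    have h4 : (‖1 - inner ℂ z w‖ : ℂ) ^ 2 = (1 - inner ℂ z w) * (1 - inner ℂ w z) := by
      rw [← Complex.mul_conj']
      simp
    simp only [inner_sub_left, inner_sub_right, mobiusLin_symm z w z, mobiusLin_self,
      inner_self_mobiusLin, Complex.coe_algebraMap] at h1 h2 h3
    rw [h3, hA, h2] at h1
    rw [← h1, h4]
    ring
  rw [mobius_eq, norm_smul, norm_inv, mul_pow, inv_pow]
  have hN' : ‖z - mobiusLin z w‖ ^ 2 =
      ‖1 - inner ℂ z w‖ ^ 2 - (1 - ‖z‖ ^ 2) * (1 - ‖w‖ ^ 2) := by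
    exact_mod_cast hN
  rw [hN']
  field_simp
  ring

theorem norm_mobius_lt_one {z w : Cn n} (hz : ‖z‖ < 1) (hw : ‖w‖ < 1) : ‖mobius z w‖ < 1 := by
  have h := one_sub_norm_sq_mobius hz hw
  have hd : 0 < ‖1 - inner ℂ z w‖ := norm_pos_iff.mpr (one_sub_inner_ne_zero hz hw.le)
  have h1 : 0 < 1 - ‖z‖ ^ 2 := by nlinarith [norm_nonneg z]
  have h2 : 0 < 1 - ‖w‖ ^ 2 := by nlinarith [norm_nonneg w]
  have : 0 < 1 - ‖mobius z w‖ ^ 2 := by rw [h]; positivity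
  nlinarith [norm_nonneg (mobius z w)]

theorem one_sub_inner_self_mobius {z w : Cn n} (hz : ‖z‖ < 1) (hw : ‖w‖ < 1) :
    1 - inner ℂ z (mobius z w) = (1 - (‖z‖ : ℂ) ^ 2) / (1 - inner ℂ z w) := by
  have hd := one_sub_inner_ne_zero hz hw.le
  have h2 := inner_self_eq_norm_sq_to_K (𝕜 := ℂ) z
  simp only [Complex.coe_algebraMap] at h2
  rw [mobius_eq, inner_smul_right, inner_sub_right, inner_self_mobiusLin, h2]
  field_simp
  ring

theorem mobius_mobius {z w : Cn n} (hz : ‖z‖ < 1) (hw : ‖w‖ < 1) : mobius z (mobius z w) = w := by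
  have hd := one_sub_inner_ne_zero hz hw.le
  have hz' : (1 - (‖z‖ : ℂ) ^ 2) ≠ 0 := by
    have : (0 : ℝ) < 1 - ‖z‖ ^ 2 := by nlinarith [norm_nonneg z]
    exact_mod_cast this.ne'
  rw [mobius_eq z (mobius z w), one_sub_inner_self_mobius hz hw, mobius_eq z w, map_smul, map_sub,
    mobiusLin_self, mobiusLin_mobiusLin hz]
  have : z - (1 - inner ℂ z w)⁻¹ • (z - ((1 - (‖z‖ : ℂ) ^ 2) • w + inner ℂ z w • z)) =
      ((1 - (‖z‖ : ℂ) ^ 2) / (1 - inner ℂ z w)) • w := by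
    have : z = (1 - inner ℂ z w)⁻¹ • ((1 - inner ℂ z w) • z) := by
      rw [smul_smul, inv_mul_cancel₀ hd, one_smul]
    nth_rewrite 1 [this]
    rw [div_eq_inv_mul]
    module
  rw [this, smul_smul, inv_mul_cancel₀ (div_ne_zero hz' hd), one_smul]

theorem mobius_zero (z : Cn n) : mobius z 0 = z := by simp [mobius_eq]

theorem mobius_self (z : Cn n) : mobius z z = 0 := by simp [mobius_eq, mobiusLin_self]

/-- Clearing denominators turns both sides into `1 - ⟨a,z⟩ - ⟨z,w⟩ + ⟨a, A w⟩`, because `A` is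
self-adjoint. -/
theorem one_sub_inner_mobius_mul {z a w : Cn n} (hz : ‖z‖ < 1) (ha : ‖a‖ < 1) (hw : ‖w‖ < 1) :
    (1 - inner ℂ a z) * (1 - inner ℂ (mobius z a) w) =
      (1 - inner ℂ z w) * (1 - inner ℂ a (mobius z w)) := by
  have hd := one_sub_inner_ne_zero hz hw.le
  have hd' := one_sub_inner_ne_zero ha hz.le
  rw [mobius_eq, mobius_eq, inner_smul_left, inner_smul_right, inner_sub_left, inner_sub_right,
    mobiusLin_symm]
  simp only [map_inv₀, map_sub, map_one, inner_conj_symm]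
  field_simp
  ring

/-- Möbius covariance of the kernel. It plays the role of the weighted composition operators
attached to `φ_z`, without having to define them on `A^p`. -/
theorem kernelFun_mul_kernelFun_mobius {z a w : Cn n} (hz : ‖z‖ < 1) (ha : ‖a‖ < 1)
    (hw : ‖w‖ < 1) :
    kernelFun z w * kernelFun a (mobius z w) = kernelFun a z * kernelFun (mobius z a) w := by
  simp only [kernelFun, ← mul_inv, ← mul_pow, one_sub_inner_mobius_mul hz ha hw]

theorem differentiableOn_mobius {z : Cn n} (hz : ‖z‖ < 1) :
    DifferentiableOn ℂ (mobius z) (unitBall n) := by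
  have h : mobius z = fun w => (1 - inner ℂ z w)⁻¹ • (z - mobiusLin z w) :=
    funext (mobius_eq z)
  rw [h]
  refine DifferentiableOn.smul (DifferentiableOn.inv ?_ fun w hw =>
    one_sub_inner_ne_zero hz (mem_ball_zero_iff.mp hw).le) ?_
  · exact ((differentiable_const (1 : ℂ)).sub (innerSL ℂ z).differentiable).differentiableOn
  · exact ((differentiable_const z).sub (mobiusLin z).differentiable).differentiableOn

/-! ### Jacobian of the involution and the `L²` norm of the kernel -/

/-- The complex derivative of the Möbius involution `φ_z` at `w`. -/
def mobiusDeriv (z w : Cn n) : Cn n →L[ℂ] Cn n :=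
  (1 - inner ℂ z w)⁻¹ • ((innerSL ℂ z).smulRight (mobius z w) - mobiusLin z)

theorem hasFDerivAt_mobius {z w : Cn n} (hz : ‖z‖ < 1) (hw : ‖w‖ < 1) :
    HasFDerivAt (mobius z) (mobiusDeriv z w) w := by
  have hd := one_sub_inner_ne_zero hz hw.le
  have h : mobius z = fun w => (1 - inner ℂ z w)⁻¹ • (z - mobiusLin z w) :=
    funext (mobius_eq z)
  have h1 : HasFDerivAt (fun w => 1 - inner ℂ z w) (-(innerSL ℂ z)) w := by
    simpa using (innerSL ℂ z).hasFDerivAt (x := w).const_sub 1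
  have h2 : HasFDerivAt (fun w => z - mobiusLin z w) (-(mobiusLin z)) w :=
    (mobiusLin z).hasFDerivAt.const_sub z
  have h3 := ((hasDerivAt_inv hd).comp_hasFDerivAt w h1).smul h2
  rw [h]
  convert! h3 using 1
  ext1 v
  simp only [mobiusDeriv, mobius_eq, Function.comp_apply, add_apply, smul_apply, sub_apply,
    neg_apply, ContinuousLinearMap.smulRight_apply, innerSL_apply_apply, smul_eq_mul]
  have : -((1 - inner ℂ z w) ^ 2)⁻¹ * -(inner ℂ z v) =
    (1 - inner ℂ z w)⁻¹ * (inner ℂ z v * (1 - inner ℂ z w)⁻¹) := by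
    field_simp
  rw [this]
  module

/-- Exhibits `A` as a scalar plus a rank-one map, ready for the determinant. The convention `0⁻¹ =
0` makes it valid at `z = 0`. -/
theorem mobiusLin_apply (z w : Cn n) : mobiusLin z w =
    ((Real.sqrt (1 - ‖z‖ ^ 2) : ℝ) : ℂ) • w +
      ((1 - ((Real.sqrt (1 - ‖z‖ ^ 2) : ℝ) : ℂ)) * ((‖z‖ : ℂ) ^ 2)⁻¹ * inner ℂ z w) • z := by
  have hP : (ℂ ∙ z).starProjection w = ((‖z‖ : ℂ) ^ 2)⁻¹ • inner ℂ z w • z := by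
    rw [← norm_sq_smul_starProjection]
    rcases eq_or_ne z 0 with rfl | hz
    · simp
    · rw [smul_smul, inv_mul_cancel₀, one_smul]
      simpa using hz
  simp only [mobiusLin, add_apply, smul_apply, sub_apply, ContinuousLinearMap.id_apply, hP]
  module

/-- The derivative is a scalar multiple of a transvection `x ↦ x + ⟨z,x⟩ v`, whose determinant is `1
+ ⟨z,v⟩`. -/
theorem det_mobiusDeriv {z w : Cn n} (hz : ‖z‖ < 1) (hw : ‖w‖ < 1) :
    (mobiusDeriv z w).toLinearMap.det = (1 - inner ℂ z w)⁻¹ ^ n *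
      ((-((Real.sqrt (1 - ‖z‖ ^ 2) : ℝ) : ℂ)) ^ n *
        (((Real.sqrt (1 - ‖z‖ ^ 2) : ℝ) : ℂ) / (1 - inner ℂ z w))) := by
  have hd := one_sub_inner_ne_zero hz hw.le
  have hpos : (0 : ℝ) < 1 - ‖z‖ ^ 2 := by nlinarith [norm_nonneg z]
  have hs : ((Real.sqrt (1 - ‖z‖ ^ 2) : ℝ) : ℂ) ^ 2 = 1 - (‖z‖ : ℂ) ^ 2 := by
    rw [← Complex.ofReal_pow, Real.sq_sqrt hpos.le]
    simp
  have hs0 : ((Real.sqrt (1 - ‖z‖ ^ 2) : ℝ) : ℂ) ≠ 0 := by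
    exact_mod_cast (Real.sqrt_pos.mpr hpos).ne'
  have hs1 : z = 0 → ((Real.sqrt (1 - ‖z‖ ^ 2) : ℝ) : ℂ) = 1 := by
    rintro rfl; simp
  have hA := mobiusLin_apply z
  set s : ℂ := ((Real.sqrt (1 - ‖z‖ ^ 2) : ℝ) : ℂ)
  set v : Cn n := s⁻¹ • (((1 - s) * ((‖z‖ : ℂ) ^ 2)⁻¹) • z - mobius z w) with hv
  have key : (mobiusDeriv z w).toLinearMap = (1 - inner ℂ z w)⁻¹ • ((-s) •
      LinearMap.transvection (innerSL ℂ z).toLinearMap v) := by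
    ext1 x
    have hvv : (-s) • (x + inner ℂ z x • v) = -(s • x) - inner ℂ z x •
        (((1 - s) * ((‖z‖ : ℂ) ^ 2)⁻¹) • z - mobius z w) := by
      have : s • v = ((1 - s) * ((‖z‖ : ℂ) ^ 2)⁻¹) • z - mobius z w := by
        rw [hv, smul_smul, mul_inv_cancel₀ hs0, one_smul]
      rw [← this]
      module
    simp only [mobiusDeriv, ContinuousLinearMap.coe_coe, smul_apply, sub_apply, hA,
      ContinuousLinearMap.smulRight_apply, innerSL_apply_apply, LinearMap.smul_apply,
      LinearMap.transvection.apply, hvv]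
    module
  have hz2 := inner_self_eq_norm_sq_to_K (𝕜 := ℂ) z
  simp only [Complex.coe_algebraMap] at hz2
  have hval : (1 : ℂ) + inner ℂ z v = s / (1 - inner ℂ z w) := by
    have h1 := one_sub_inner_self_mobius hz hw
    have h2 : inner ℂ z (mobius z w) = 1 - s ^ 2 / (1 - inner ℂ z w) := by
      rw [hs, ← h1]; ring
    have h3 : (1 - s) * ((‖z‖ : ℂ) ^ 2)⁻¹ * (‖z‖ : ℂ) ^ 2 = 1 - s := by
      rcases eq_or_ne z 0 with h0 | h0
      · simp [hs1 h0]
      · rw [mul_assoc, inv_mul_cancel₀, mul_one]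
        simpa using h0
    rw [hv, inner_smul_right, inner_sub_right, inner_smul_right, hz2, h3, h2]
    field_simp
    ring
  rw [key, LinearMap.det_smul, LinearMap.det_smul, LinearMap.transvection.det]
  simp [hval]

theorem abs_det_mobiusDeriv {z w : Cn n} (hz : ‖z‖ < 1) (hw : ‖w‖ < 1) :
    |((mobiusDeriv z w).restrictScalars ℝ).det| =
      (1 - ‖z‖ ^ 2) ^ (n + 1) * ‖kernelFun z w‖ ^ 2 := by
  have h : ((mobiusDeriv z w).restrictScalars ℝ).det =
      ‖(mobiusDeriv z w).toLinearMap.det‖ ^ 2 := by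
    have := LinearMap.det_restrictScalars (R := ℝ) (f := (mobiusDeriv z w).toLinearMap)
    rw [Algebra.norm_complex_apply, Complex.normSq_eq_norm_sq] at this
    exact this
  have hpos : (0 : ℝ) ≤ 1 - ‖z‖ ^ 2 := by nlinarith [norm_nonneg z]
  rw [h, det_mobiusDeriv hz hw, abs_of_nonneg (by positivity)]
  simp only [kernelFun, norm_mul, norm_pow, norm_inv, norm_neg, norm_div, Complex.norm_real,
    Real.norm_of_nonneg (Real.sqrt_nonneg _)]
  set s := Real.sqrt (1 - ‖z‖ ^ 2)
  have : 1 - ‖z‖ ^ 2 = s ^ 2 := (Real.sq_sqrt hpos).symm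
  rw [this]
  have hd : ‖1 - inner ℂ z w‖ ≠ 0 := norm_ne_zero_iff.mpr (one_sub_inner_ne_zero hz hw.le)
  rw [inv_pow, div_eq_mul_inv]
  field_simp
  ring

theorem image_mobius_unitBall {z : Cn n} (hz : ‖z‖ < 1) :
    mobius z '' unitBall n = unitBall n := by
  ext w
  simp only [Set.mem_image, mem_ball_zero_iff]
  constructor
  · rintro ⟨x, hx, rfl⟩
    exact norm_mobius_lt_one hz hx
  · intro hw
    exact ⟨mobius z w, norm_mobius_lt_one hz hw, mobius_mobius hz hw⟩

/-- Change of variables for the constant 1: `φ_z` maps the ball bijectively to itself with real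
Jacobian `(1-|z|²)^{n+1} |K_z|²`. The reproducing property is not needed. -/
theorem setLIntegral_enorm_kernelFun_sq {z : Cn n} (hz : ‖z‖ < 1) :
    ENNReal.ofReal ((1 - ‖z‖ ^ 2) ^ (n + 1)) *
      ∫⁻ w in unitBall n, ‖kernelFun z w‖ₑ ^ 2 = volume (unitBall n) := by
  have h := lintegral_image_eq_lintegral_abs_det_fderiv_mul (volume : Measure (Cn n))
    (s := unitBall n) (f := mobius z) (f' := fun w => (mobiusDeriv z w).restrictScalars ℝ)
    Metric.isOpen_ball.measurableSet
    (fun w hw => ((hasFDerivAt_mobius hz (mem_ball_zero_iff.mp hw)).restrictScalars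
      ℝ).hasFDerivWithinAt)
    (fun x hx y hy hxy => by
      rw [← mobius_mobius hz (mem_ball_zero_iff.mp hx), hxy,
        mobius_mobius hz (mem_ball_zero_iff.mp hy)]) (fun _ => 1)
  have hpos : (0 : ℝ) ≤ (1 - ‖z‖ ^ 2) ^ (n + 1) := by
    have : 0 ≤ 1 - ‖z‖ ^ 2 := by nlinarith [norm_nonneg z]
    positivity
  rw [image_mobius_unitBall hz, setLIntegral_one] at h
  rw [h, ← lintegral_const_mul' _ _ ENNReal.ofReal_ne_top]
  refine setLIntegral_congr_fun Metric.isOpen_ball.measurableSet fun w hw => ?_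
  beta_reduce
  rw [abs_det_mobiusDeriv hz (mem_ball_zero_iff.mp hw), ENNReal.ofReal_mul hpos, mul_one,
    ENNReal.ofReal_pow (norm_nonneg _), ofReal_norm]

instance isProbabilityMeasure_ballMeasure : IsProbabilityMeasure (ballMeasure n) := by
  constructor
  rw [ballMeasure, Measure.smul_apply, Measure.restrict_apply_univ, smul_eq_mul]
  exact ENNReal.inv_mul_cancel (Metric.measure_ball_pos volume (0 : Cn n) one_pos).ne'
    measure_ball_lt_top.ne

theorem ae_mem_unitBall : ∀ᵐ w ∂(ballMeasure n), w ∈ unitBall n :=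
  Measure.ae_smul_measure (ae_restrict_mem Metric.isOpen_ball.measurableSet) _

theorem lintegral_enorm_kernelFun_sq {z : Cn n} (hz : ‖z‖ < 1) :
    ∫⁻ w, ‖kernelFun z w‖ₑ ^ 2 ∂(ballMeasure n) =
      ENNReal.ofReal (((1 - ‖z‖ ^ 2) ^ (n + 1))⁻¹) := by
  have h := setLIntegral_enorm_kernelFun_sq hz
  have hpos : (0 : ℝ) < (1 - ‖z‖ ^ 2) ^ (n + 1) := by
    have : 0 < 1 - ‖z‖ ^ 2 := by nlinarith [norm_nonneg z]
    positivity
  have hv : volume (unitBall n) ≠ 0 := (Metric.measure_ball_pos volume (0 : Cn n) one_pos).ne'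
  have hv' : volume (unitBall n) ≠ ∞ := measure_ball_lt_top.ne
  rw [ballMeasure, lintegral_smul_measure, smul_eq_mul, ENNReal.ofReal_inv_of_pos hpos]
  refine ENNReal.eq_inv_of_mul_eq_one_left ?_
  rw [mul_assoc, mul_comm _ (ENNReal.ofReal _), h, ENNReal.inv_mul_cancel hv hv']

theorem norm_K_two_sq (z : unitBall n) :
    ‖K 2 z‖ ^ 2 = ((1 - ‖(z : Cn n)‖ ^ 2) ^ (n + 1))⁻¹ := by
  have hz : ‖(z : Cn n)‖ < 1 := mem_ball_zero_iff.mp z.2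
  have hpos : (0 : ℝ) < (1 - ‖(z : Cn n)‖ ^ 2) ^ (n + 1) := by
    have : 0 < 1 - ‖(z : Cn n)‖ ^ 2 := by nlinarith [norm_nonneg (z : Cn n)]
    positivity
  have h1 : ‖K 2 z‖ = (eLpNorm (kernelFun (z : Cn n)) 2 (ballMeasure n)).toReal :=
    Lp.norm_toLp _ (kernelFun_memLp 2 z)
  rw [h1, ← ENNReal.toReal_pow, eLpNorm_eq_lintegral_rpow_enorm_toReal two_ne_zero
    ENNReal.ofNat_ne_top]
  simp only [ENNReal.toReal_ofNat, ENNReal.rpow_ofNat]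
  rw [lintegral_enorm_kernelFun_sq hz, ← ENNReal.rpow_ofNat, ← ENNReal.rpow_mul]
  norm_num
  exact hpos.le

/-! ### Weak `L¹` bound and `A^p` norms of the kernels -/

theorem one_sub_norm_le_norm_one_sub_inner (z : Cn n) {w : Cn n} (hw : ‖w‖ < 1) :
    1 - ‖z‖ ≤ ‖1 - inner ℂ z w‖ :=
  one_sub_norm_le z (mem_ball_zero_iff.mpr hw)

/-- The nonisotropic balls `{w : |1 - \bar z w| < δ}` have measure `O(δ^{n+1})`. -/
theorem ballMeasure_norm_one_sub_inner_lt_le {z : Cn n} (hz : ‖z‖ < 1) {δ : ℝ} (hδ : 0 < δ) :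
    ballMeasure n {w | ‖1 - inner ℂ z w‖ < δ} ≤ ENNReal.ofReal (4 ^ (n + 1) * δ ^ (n + 1)) := by
  rcases le_or_gt 1 δ with h1 | h1
  · refine prob_le_one.trans ?_
    rw [← ENNReal.ofReal_one]
    refine ENNReal.ofReal_le_ofReal ?_
    rw [← mul_pow]
    exact one_le_pow₀ (by linarith)
  rcases le_or_gt δ (1 - ‖z‖) with h2 | h2
  · refine le_trans (le_of_eq ?_) zero_le
    rw [measure_eq_zero_iff_ae_notMem]
    filter_upwards [ae_mem_unitBall] with w hw
    have := one_sub_norm_le z hw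
    simp only [not_lt]
    linarith
  have hz0 : 0 < ‖z‖ := by linarith
  -- Pull `z` back radially to norm `1 - δ`. Then `|1 - ⟨y,w⟩| ≤ 2δ` on the set, so `|K_y|²` is
  -- large there, while `1 - |y|² ≥ δ` bounds its integral; Chebyshev gives `(2δ)^{2(n+1)}
  -- δ^{-(n+1)}`.
  set y : Cn n := (((1 - δ) / ‖z‖ : ℝ) : ℂ) • z with hy
  have hyn : ‖y‖ = 1 - δ := by
    rw [hy, norm_smul, Complex.norm_real, Real.norm_of_nonneg (by
      have : 0 ≤ 1 - δ := by linarith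
      positivity)]
    field_simp
  have hzy : ‖z - y‖ ≤ δ := by
    have : z - y = ((1 - (1 - δ) / ‖z‖ : ℝ) : ℂ) • z := by
      rw [hy]; push_cast; module
    rw [this, norm_smul, Complex.norm_real, Real.norm_of_nonneg]
    · have : (1 - (1 - δ) / ‖z‖) * ‖z‖ = ‖z‖ - (1 - δ) := by field_simp
      rw [this]; linarith
    · rw [sub_nonneg, div_le_one hz0]; linarith
  have hy1 : ‖y‖ < 1 := by linarith
  have hsub : ∀ᵐ w ∂(ballMeasure n), w ∈ {w | ‖1 - inner ℂ z w‖ < δ} →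
      w ∈ {w | ENNReal.ofReal (((2 * δ) ^ (n + 1))⁻¹ ^ 2) ≤ ‖kernelFun y w‖ₑ ^ 2} := by
    filter_upwards [ae_mem_unitBall] with w hw hwS
    have hw1 : ‖w‖ < 1 := mem_ball_zero_iff.mp hw
    have hwS' : ‖1 - inner ℂ z w‖ < δ := hwS
    have hle : ‖1 - inner ℂ y w‖ ≤ 2 * δ := by
      have e : 1 - inner ℂ y w = (1 - inner ℂ z w) + inner ℂ (z - y) w := by
        rw [inner_sub_left]; ring
      have h3 : ‖inner ℂ (z - y) w‖ ≤ ‖z - y‖ * ‖w‖ := norm_inner_le_norm _ _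
      rw [e]
      refine (norm_add_le _ _).trans ?_
      nlinarith [norm_nonneg (z - y), norm_nonneg w]
    have hpos : 0 < ‖1 - inner ℂ y w‖ := norm_pos_iff.mpr (one_sub_inner_ne_zero hy1 hw1.le)
    change _ ≤ ‖kernelFun y w‖ₑ ^ 2
    rw [← ofReal_norm, ← ENNReal.ofReal_pow (norm_nonneg _)]
    refine ENNReal.ofReal_le_ofReal ?_
    rw [kernelFun, norm_inv, norm_pow]
    gcongr
  refine (measure_mono_ae hsub).trans ?_
  have hmeas : AEMeasurable (fun w => ‖kernelFun y w‖ₑ ^ 2) (ballMeasure n) :=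
    ((kernelFun_memLp 2 ⟨y, mem_ball_zero_iff.mpr hy1⟩).1.enorm).pow_const 2
  have hcheb := mul_meas_ge_le_lintegral₀ hmeas (ENNReal.ofReal (((2 * δ) ^ (n + 1))⁻¹ ^ 2))
  rw [lintegral_enorm_kernelFun_sq hy1] at hcheb
  have hc0 : 0 < ((2 * δ) ^ (n + 1))⁻¹ ^ 2 := by positivity
  rw [mul_comm, ← ENNReal.le_div_iff_mul_le (Or.inl (ENNReal.ofReal_pos.mpr hc0).ne')
    (Or.inl ENNReal.ofReal_ne_top), ← ENNReal.ofReal_div_of_pos hc0] at hcheb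
  refine hcheb.trans (ENNReal.ofReal_le_ofReal ?_)
  have h4 : ((1 - ‖y‖ ^ 2) ^ (n + 1))⁻¹ ≤ (δ ^ (n + 1))⁻¹ := by
    rw [hyn]
    gcongr
    nlinarith
  calc ((1 - ‖y‖ ^ 2) ^ (n + 1))⁻¹ / ((2 * δ) ^ (n + 1))⁻¹ ^ 2
      ≤ (δ ^ (n + 1))⁻¹ / ((2 * δ) ^ (n + 1))⁻¹ ^ 2 := by gcongr
    _ = 4 ^ (n + 1) * δ ^ (n + 1) := by
      have : (4 : ℝ) ^ (n + 1) = (2 ^ (n + 1)) ^ 2 := by rw [← pow_mul, mul_comm, pow_mul]; norm_num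
      rw [this, mul_pow]
      field_simp

/-- The Bergman kernels are bounded in weak `L¹`. -/
theorem ballMeasure_lt_norm_kernelFun_le {z : Cn n} (hz : ‖z‖ < 1) {t : ℝ} (ht : 0 < t) :
    ballMeasure n {w | t < ‖kernelFun z w‖} ≤ ENNReal.ofReal (4 ^ (n + 1) * t⁻¹) := by
  set δ : ℝ := (t⁻¹) ^ (((n + 1 : ℕ) : ℝ)⁻¹) with hδ
  have hδ0 : 0 < δ := by positivity
  have hδp : δ ^ (n + 1) = t⁻¹ := Real.rpow_inv_natCast_pow (by positivity) (by omega)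
  rw [← hδp]
  refine (measure_mono_ae ?_).trans (ballMeasure_norm_one_sub_inner_lt_le hz hδ0)
  filter_upwards [ae_mem_unitBall] with w hw hwt
  have hpos : 0 < ‖1 - inner ℂ z w‖ :=
    norm_pos_iff.mpr (one_sub_inner_ne_zero hz (mem_ball_zero_iff.mp hw).le)
  have hwt' : t < ‖kernelFun z w‖ := hwt
  rw [kernelFun, norm_inv, norm_pow] at hwt'
  have : ‖1 - inner ℂ z w‖ ^ (n + 1) < δ ^ (n + 1) := by
    rw [hδp]
    exact (lt_inv_comm₀ ht (by positivity)).mp hwt'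
  exact lt_of_pow_lt_pow_left₀ _ hδ0.le this

theorem norm_kernelFun_le {z w : Cn n} (hz : ‖z‖ < 1) (hw : ‖w‖ < 1) :
    ‖kernelFun z w‖ ≤ ((1 - ‖z‖) ^ (n + 1))⁻¹ := by
  have h0 : 0 < 1 - ‖z‖ := by linarith
  have h1 := one_sub_norm_le_norm_one_sub_inner z hw
  rw [kernelFun, norm_inv, norm_pow]
  gcongr

/-- Layer cake: the weak `L¹` bound gives an integrand of order `t^{q-2}`, integrable at 0 since `q
> 1`, and the level sets are null beyond the supremum bound `M = (1-|z|)^{-(n+1)}`. -/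
theorem lintegral_norm_kernelFun_rpow_le {q : ℝ} (hq : 1 < q) {z : Cn n} (hz : ‖z‖ < 1) :
    ∫⁻ w, ENNReal.ofReal (‖kernelFun z w‖ ^ q) ∂(ballMeasure n) ≤
      ENNReal.ofReal (q / (q - 1) * 4 ^ (n + 1) * (((1 - ‖z‖) ^ (n + 1))⁻¹) ^ (q - 1)) := by
  have h0 : 0 < 1 - ‖z‖ := by linarith
  have hmeas : AEMeasurable (fun w => ‖kernelFun z w‖) (ballMeasure n) :=
    (kernelFun_memLp 2 ⟨z, mem_ball_zero_iff.mpr hz⟩).1.norm.aemeasurable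
  set M : ℝ := ((1 - ‖z‖) ^ (n + 1))⁻¹ with hM
  have hM0 : 0 < M := by positivity
  rw [lintegral_rpow_eq_lintegral_meas_lt_mul _ (ae_of_all _ fun w => norm_nonneg _) hmeas
    (by linarith : 0 < q)]
  have hint : IntervalIntegrable (fun t : ℝ => t ^ (q - 2)) volume 0 M :=
    intervalIntegral.intervalIntegrable_rpow' (by linarith)
  have hbound : ∫⁻ t in Set.Ioi (0 : ℝ), ballMeasure n {w | t < ‖kernelFun z w‖} *
        ENNReal.ofReal (t ^ (q - 1)) ≤
      ∫⁻ t in Set.Ioc 0 M, ENNReal.ofReal (4 ^ (n + 1) * t ^ (q - 2)) := by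
    rw [← lintegral_indicator measurableSet_Ioi, ← lintegral_indicator measurableSet_Ioc]
    refine lintegral_mono fun t => ?_
    by_cases ht : t ∈ Set.Ioi (0 : ℝ)
    · have ht0 : 0 < t := ht
      rw [Set.indicator_of_mem ht]
      rcases le_or_gt t M with htM | htM
      · have hmem : t ∈ Set.Ioc 0 M := ⟨ht0, htM⟩
        rw [Set.indicator_of_mem hmem]
        refine (mul_le_mul_left (ballMeasure_lt_norm_kernelFun_le hz ht0) _).trans ?_
        rw [← ENNReal.ofReal_mul (by positivity)]
        refine ENNReal.ofReal_le_ofReal (le_of_eq ?_)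
        have : t ^ (q - 2) = t ^ (q - 1) * t⁻¹ := by
          rw [← Real.rpow_neg_one t, ← Real.rpow_add ht0]
          ring_nf
        rw [this]
        ring
      · have : ballMeasure n {w | t < ‖kernelFun z w‖} = 0 := by
          rw [measure_eq_zero_iff_ae_notMem]
          filter_upwards [ae_mem_unitBall] with w hw
          have := norm_kernelFun_le hz (mem_ball_zero_iff.mp hw)
          simp only [not_lt]
          exact this.trans htM.le
        simp [this]
    · simp [Set.indicator_of_notMem ht]
  refine (mul_le_mul_right hbound _).trans ?_
  rw [← ofReal_integral_eq_lintegral_ofReal]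
  · rw [← ENNReal.ofReal_mul (by linarith), ← intervalIntegral.integral_of_le hM0.le,
      intervalIntegral.integral_const_mul, integral_rpow (Or.inl (by linarith))]
    refine ENNReal.ofReal_le_ofReal (le_of_eq ?_)
    have e : q - 2 + 1 = q - 1 := by ring
    rw [e, Real.zero_rpow (by linarith), sub_zero]
    ring
  · exact ((intervalIntegrable_iff_integrableOn_Ioc_of_le hM0.le).mp hint).const_mul _
  · filter_upwards [ae_restrict_mem measurableSet_Ioc] with t ht
    have : 0 < t := ht.1
    positivity

/-- The exponents `1 - 1/p` and `1 - 1/p'` add up to 1, so the product of the two kernel norms is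
`O((1-|z|)^{-(n+1)})`, exactly what the normalization absorbs. -/
theorem exists_norm_K_le {p : ℝ≥0∞} [Fact (1 ≤ p)] (hp : 1 < p) (hp_top : p < ∞) :
    ∃ C : ℝ, 0 ≤ C ∧ ∀ z : unitBall n,
      ‖K p z‖ ≤ C * (((1 - ‖(z : Cn n)‖) ^ (n + 1))⁻¹) ^ (1 - 1 / p.toReal) := by
  have hq : 1 < p.toReal := by
    rw [← ENNReal.toReal_one]
    exact (ENNReal.toReal_lt_toReal ENNReal.one_ne_top hp_top.ne).mpr hp
  set q := p.toReal
  refine ⟨(q / (q - 1) * 4 ^ (n + 1)) ^ (1 / q), ?_, fun z => ?_⟩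
  · have : 0 < q - 1 := by linarith
    positivity
  have hz : ‖(z : Cn n)‖ < 1 := mem_ball_zero_iff.mp z.2
  have h0 : 0 < 1 - ‖(z : Cn n)‖ := by linarith
  have hq1 : 0 < q - 1 := by linarith
  have h1 : ‖K p z‖ = (eLpNorm (kernelFun (z : Cn n)) p (ballMeasure n)).toReal :=
    Lp.norm_toLp _ (kernelFun_memLp p z)
  have h2 := lintegral_norm_kernelFun_rpow_le hq hz
  rw [h1, eLpNorm_eq_lintegral_rpow_enorm_toReal (by positivity) hp_top.ne]
  set M : ℝ := ((1 - ‖(z : Cn n)‖) ^ (n + 1))⁻¹ with hM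
  have hM0 : 0 < M := by positivity
  have h3 : ∫⁻ w, ‖kernelFun (z : Cn n) w‖ₑ ^ q ∂(ballMeasure n) =
      ∫⁻ w, ENNReal.ofReal (‖kernelFun (z : Cn n) w‖ ^ q) ∂(ballMeasure n) := by
    refine lintegral_congr fun w => ?_
    rw [← ENNReal.ofReal_rpow_of_nonneg (norm_nonneg _) (by linarith), ofReal_norm]
  rw [h3]
  have h4 : (∫⁻ w, ENNReal.ofReal (‖kernelFun (z : Cn n) w‖ ^ q) ∂(ballMeasure n)) ^ (1 / q) ≤
      ENNReal.ofReal ((q / (q - 1) * 4 ^ (n + 1)) ^ (1 / q) * M ^ (1 - 1 / q)) := by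
    refine (ENNReal.rpow_le_rpow h2 (by positivity)).trans (le_of_eq ?_)
    rw [ENNReal.ofReal_rpow_of_nonneg (by positivity) (by positivity),
      Real.mul_rpow (by positivity) (by positivity), ← Real.rpow_mul hM0.le]
    congr 3
    field_simp
  refine ENNReal.toReal_le_of_le_ofReal (by positivity) h4

/-! ### Recovering coefficients of a double power series from its diagonal -/

theorem integral_conj_pow_mul_pow_mul_exp (r : ℝ) (j k m : ℕ) :
    ∫ θ in (0 : ℝ)..2 * Real.pi, conj (circleMap 0 r θ) ^ j * circleMap 0 r θ ^ k *
      Complex.exp (-(m * θ * Complex.I)) =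
    if k = j + m then 2 * Real.pi * (r : ℂ) ^ (j + k) else 0 := by
  have h : ∀ θ : ℝ, conj (circleMap 0 r θ) ^ j * circleMap 0 r θ ^ k *
      Complex.exp (-(m * θ * Complex.I)) =
      (r : ℂ) ^ (j + k) * Complex.exp ((((k : ℂ) - j - m) * Complex.I) * θ) := by
    intro θ
    simp only [circleMap, zero_add, map_mul, Complex.conj_ofReal, ← Complex.exp_conj,
      Complex.conj_I, mul_pow, ← Complex.exp_nat_mul]
    have : Complex.exp ((((k : ℂ) - j - m) * Complex.I) * θ) =
        Complex.exp (j * (θ * -Complex.I)) * Complex.exp (k * (θ * Complex.I)) *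
          Complex.exp (-(m * θ * Complex.I)) := by
      rw [← Complex.exp_add, ← Complex.exp_add]
      ring_nf
    rw [this]
    ring
  simp only [h]
  rw [intervalIntegral.integral_const_mul]
  split_ifs with hk
  · subst hk
    simp
    ring
  · have hc : ((k : ℂ) - j - m) * Complex.I ≠ 0 := by
      refine mul_ne_zero ?_ Complex.I_ne_zero
      intro h0
      apply hk
      have : (k : ℂ) = j + m := by linear_combination h0
      exact_mod_cast this
    rw [integral_exp_mul_complex hc]
    have : ((k : ℂ) - j - m) * Complex.I * ((2 * Real.pi : ℝ) : ℂ) =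
        ((k - j - m : ℤ) : ℂ) * (2 * Real.pi * Complex.I) := by
      push_cast; ring
    rw [this, Complex.exp_int_mul_two_pi_mul_I]
    simp

/-- The `m`-th Fourier coefficient of a double power series in `\bar λ`, `λ` on a circle. -/
theorem norm_tsum_diagonal_le {d : ℕ × ℕ → ℂ} {r ε : ℝ} (hr : 0 ≤ r) (m : ℕ)
    (hs : Summable fun q : ℕ × ℕ => ‖d q‖ * r ^ (q.1 + q.2))
    (h : ∀ x : ℂ, ‖x‖ = r → ‖∑' q : ℕ × ℕ, d q * (conj x ^ q.1 * x ^ q.2)‖ ≤ ε) :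
    ‖∑' q : ℕ × ℕ, if q.2 = q.1 + m then d q * (r : ℂ) ^ (q.1 + q.2) else 0‖ ≤ ε := by
  have hnorm : ∀ θ, ‖circleMap 0 r θ‖ = r := fun θ => by simp [abs_of_nonneg hr]
  have hexp : ∀ θ : ℝ, ‖Complex.exp (-(m * θ * Complex.I))‖ = 1 := fun θ => by
    have : -((m : ℂ) * θ * Complex.I) = ((-(m * θ) : ℝ) : ℂ) * Complex.I := by push_cast; ring
    rw [this, Complex.norm_exp_ofReal_mul_I]
  have hn : ∀ (q : ℕ × ℕ) (θ : ℝ), ‖d q * (conj (circleMap 0 r θ) ^ q.1 *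
      circleMap 0 r θ ^ q.2)‖ = ‖d q‖ * r ^ (q.1 + q.2) := fun q θ => by
    rw [norm_mul, norm_mul, norm_pow, norm_pow, RCLike.norm_conj, hnorm, pow_add]
  have hsum := intervalIntegral.hasSum_integral_of_dominated_convergence (μ := volume)
    (a := 0) (b := 2 * Real.pi)
    (F := fun (q : ℕ × ℕ) θ => d q * (conj (circleMap 0 r θ) ^ q.1 *
      circleMap 0 r θ ^ q.2) * Complex.exp (-(m * θ * Complex.I)))
    (f := fun θ => (∑' q : ℕ × ℕ, d q * (conj (circleMap 0 r θ) ^ q.1 *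
      circleMap 0 r θ ^ q.2)) * Complex.exp (-(m * θ * Complex.I)))
    (fun q _ => ‖d q‖ * r ^ (q.1 + q.2))
    (fun q => (by
      have := continuous_circleMap 0 r
      fun_prop : Continuous _).aestronglyMeasurable)
    (fun q => ae_of_all _ fun θ _ => by rw [norm_mul, hn, hexp, mul_one])
    (ae_of_all _ fun θ _ => hs)
    intervalIntegrable_const
    (ae_of_all _ fun θ _ => by
      refine HasSum.mul_right _ (Summable.hasSum (Summable.of_norm ?_))
      simpa only [hn] using hs)
  have hterm : ∀ q : ℕ × ℕ, ∫ θ in (0 : ℝ)..2 * Real.pi, d q * (conj (circleMap 0 r θ) ^ q.1 *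
      circleMap 0 r θ ^ q.2) * Complex.exp (-(m * θ * Complex.I)) =
      2 * Real.pi * (if q.2 = q.1 + m then d q * (r : ℂ) ^ (q.1 + q.2) else 0) := fun q => by
    simp only [mul_assoc (d q)]
    rw [intervalIntegral.integral_const_mul, integral_conj_pow_mul_pow_mul_exp]
    split_ifs
    · ring
    · simp
  simp only [hterm] at hsum
  have h1 := hsum.tsum_eq
  rw [tsum_mul_left] at h1
  have h2 : ‖∫ θ in (0 : ℝ)..2 * Real.pi, (∑' q : ℕ × ℕ, d q * (conj (circleMap 0 r θ) ^ q.1 *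
      circleMap 0 r θ ^ q.2)) * Complex.exp (-(m * θ * Complex.I))‖ ≤
      ε * |2 * Real.pi - 0| :=
    intervalIntegral.norm_integral_le_of_norm_le_const fun θ _ => by
      rw [norm_mul, hexp, mul_one]
      exact h _ (hnorm θ)
  have hpi := Real.pi_pos
  rw [← h1, norm_mul, sub_zero, abs_of_pos (by positivity)] at h2
  have h3 : ‖(2 * Real.pi : ℂ)‖ = 2 * Real.pi := by
    rw [norm_mul, Complex.norm_real, Real.norm_of_nonneg hpi.le]; simp
  rw [h3, mul_comm ε] at h2
  exact le_of_mul_le_mul_left h2 (by positivity)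

/-- The `m`-th Fourier coefficient mixes all `d (j, j+m)`, but the terms with `j ≥ 1` carry at least
two extra powers of `r`; comparison with the series at radius `R` bounds them by `(r/R)^{m+2}` times
its sum. -/
theorem norm_coeff_zero_le {d : ℕ × ℕ → ℂ} {r R ε : ℝ} (hr : 0 < r) (hrR : r ≤ R) (m : ℕ)
    (hs : Summable fun q : ℕ × ℕ => ‖d q‖ * R ^ (q.1 + q.2))
    (h : ∀ x : ℂ, ‖x‖ = r → ‖∑' q : ℕ × ℕ, d q * (conj x ^ q.1 * x ^ q.2)‖ ≤ ε) :
    ‖d (0, m)‖ * r ^ m ≤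
      ε + (r / R) ^ (m + 2) * ∑' q : ℕ × ℕ, ‖d q‖ * R ^ (q.1 + q.2) := by
  have hR : 0 < R := hr.trans_le hrR
  have hs' : Summable fun q : ℕ × ℕ => ‖d q‖ * r ^ (q.1 + q.2) :=
    hs.of_nonneg_of_le (fun q => by positivity) fun q => by gcongr
  have h1 := norm_tsum_diagonal_le hr.le m hs' h
  set g : ℕ × ℕ → ℂ := fun q => if q.2 = q.1 + m then d q * (r : ℂ) ^ (q.1 + q.2) else 0 with hg
  have hgn : ∀ q, ‖g q‖ ≤ ‖d q‖ * r ^ (q.1 + q.2) := fun q => by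
    simp only [hg]
    split_ifs
    · rw [norm_mul, norm_pow, Complex.norm_real, Real.norm_of_nonneg hr.le]
    · rw [norm_zero]; positivity
  have hgs : Summable g := Summable.of_norm_bounded hs' hgn
  rw [hgs.tsum_eq_add_tsum_ite (0, m)] at h1
  have hb : ∀ q, ‖if q = (0, m) then (0 : ℂ) else g q‖ ≤
      (r / R) ^ (m + 2) * (‖d q‖ * R ^ (q.1 + q.2)) := fun q => by
    have hnn : 0 ≤ (r / R) ^ (m + 2) * (‖d q‖ * R ^ (q.1 + q.2)) := by positivity
    rcases q with ⟨j, k⟩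
    split_ifs with hq
    · rwa [norm_zero]
    by_cases hk : k = j + m
    · have hj : 1 ≤ j := by
        by_contra h0
        apply hq
        have : j = 0 := by omega
        subst this
        simp [hk]
      refine (hgn _).trans ?_
      have e : r ^ (j + k) = (r / R) ^ (j + k) * R ^ (j + k) := by
        rw [← mul_pow, div_mul_cancel₀ _ hR.ne']
      have hle : (r / R) ^ (j + k) ≤ (r / R) ^ (m + 2) :=
        pow_le_pow_of_le_one (by positivity) ((div_le_one hR).mpr hrR) (by omega)
      simp only [e]
      calc ‖d (j, k)‖ * ((r / R) ^ (j + k) * R ^ (j + k))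
          = (r / R) ^ (j + k) * (‖d (j, k)‖ * R ^ (j + k)) := by ring
        _ ≤ _ := by gcongr
    · have : g (j, k) = 0 := by simp [hg, hk]
      rw [this, norm_zero]
      exact hnn
  have h2 := tsum_of_norm_bounded (hs.mul_left ((r / R) ^ (m + 2))).hasSum hb
  rw [tsum_mul_left] at h2
  have h3 : ‖g (0, m)‖ = ‖d (0, m)‖ * r ^ m := by
    simp [hg, abs_of_pos hr]
  have h4 := norm_sub_le (g (0, m) + ∑' q, if q = (0, m) then (0 : ℂ) else g q)
    (∑' q, if q = (0, m) then (0 : ℂ) else g q)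
  rw [add_sub_cancel_right, h3] at h4
  linarith

/-- If a family of double power series in `\bar λ`, `λ` with dominated coefficients tends to zero
uniformly on a disc, then so do the coefficients of the pure powers of `λ`. -/
theorem tendsto_coeff_zero {ι : Type*} {l : Filter ι} {d : ι → ℕ × ℕ → ℂ} {b : ℕ × ℕ → ℝ} {R : ℝ}
    (hR : 0 < R) (hb : Summable fun q : ℕ × ℕ => b q * R ^ (q.1 + q.2))
    (hd : ∀ i q, ‖d i q‖ ≤ b q)
    (h : ∀ ε > 0, ∀ᶠ i in l, ∀ x : ℂ, ‖x‖ ≤ R →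
      ‖∑' q : ℕ × ℕ, d i q * (conj x ^ q.1 * x ^ q.2)‖ ≤ ε) (m : ℕ) :
    Tendsto (fun i => ‖d i (0, m)‖) l (𝓝 0) := by
  set A : ℝ := ∑' q : ℕ × ℕ, b q * R ^ (q.1 + q.2)
  rw [Metric.tendsto_nhds]
  intro η hη
  have hlim : Tendsto (fun r : ℝ => r ^ 2 * (A / R ^ (m + 2))) (𝓝[>] 0) (𝓝 0) := by
    have : Tendsto (fun r : ℝ => r ^ 2 * (A / R ^ (m + 2))) (𝓝 0) (𝓝 (0 ^ 2 * (A / R ^ (m + 2)))) :=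
      Continuous.tendsto (by fun_prop) 0
    simp only [ne_eq, OfNat.ofNat_ne_zero, not_false_eq_true, zero_pow, zero_mul] at this
    exact this.mono_left nhdsWithin_le_nhds
  -- The radius is fixed before `i`: after division by `r^m` the tail is at most `r² A / R^{m+2} <
  -- η/2`, and the tolerance `r^m η/4` used next becomes `η/4`.
  obtain ⟨r, hr1, hr0, hrR⟩ := ((hlim.eventually (gt_mem_nhds (half_pos hη))).and
    (Ioc_mem_nhdsGT hR)).exists
  filter_upwards [h (r ^ m * (η / 4)) (by positivity)] with i hi
  have hs : Summable fun q : ℕ × ℕ => ‖d i q‖ * R ^ (q.1 + q.2) :=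
    hb.of_nonneg_of_le (fun q => by positivity) fun q => by gcongr; exact hd i q
  have h1 := norm_coeff_zero_le hr0 hrR m hs fun x hx => hi x (hx.trans_le hrR)
  have h2 : ∑' q : ℕ × ℕ, ‖d i q‖ * R ^ (q.1 + q.2) ≤ A :=
    hs.tsum_le_tsum (fun q => by gcongr; exact hd i q) hb
  have h3 : ‖d i (0, m)‖ * r ^ m ≤ (η / 4 + r ^ 2 * (A / R ^ (m + 2))) * r ^ m := by
    refine h1.trans ?_
    calc r ^ m * (η / 4) + (r / R) ^ (m + 2) * ∑' q : ℕ × ℕ, ‖d i q‖ * R ^ (q.1 + q.2)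
        ≤ r ^ m * (η / 4) + (r / R) ^ (m + 2) * A := by gcongr
      _ = _ := by rw [div_pow]; field_simp; ring
  have h4 := le_of_mul_le_mul_right h3 (by positivity)
  rw [dist_zero_right, norm_norm]
  linarith

/-! ### Bounded holomorphic functions in `A^p` and expansion of transformed kernels -/

/-- Functions that are bounded and holomorphic on the unit ball. -/
def boundedHolomorphic (n : ℕ) : Submodule ℂ (Cn n → ℂ) where
  carrier := {g | DifferentiableOn ℂ g (unitBall n) ∧ ∃ C : ℝ, ∀ w ∈ unitBall n, ‖g w‖ ≤ C}
  add_mem' := by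
    rintro f g ⟨hf, A, hA⟩ ⟨hg, B, hB⟩
    exact ⟨hf.add hg, A + B, fun w hw => (norm_add_le _ _).trans (add_le_add (hA w hw) (hB w hw))⟩
  zero_mem' := ⟨differentiableOn_const 0, 0, fun w _ => by simp⟩
  smul_mem' := by
    rintro c f ⟨hf, A, hA⟩
    refine ⟨hf.const_smul c, ‖c‖ * A, fun w hw => ?_⟩
    rw [Pi.smul_apply, norm_smul]
    gcongr
    exact hA w hw

theorem memLp_of_mem_boundedHolomorphic (p : ℝ≥0∞) (g : boundedHolomorphic n) :
    MemLp (g : Cn n → ℂ) p (ballMeasure n) := by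
  obtain ⟨C, hC⟩ := g.2.2
  refine MemLp.of_bound ?_ C ?_
  · exact AEStronglyMeasurable.smul_measure
      (g.2.1.continuousOn.aestronglyMeasurable Metric.isOpen_ball.measurableSet) _
  · filter_upwards [ae_mem_unitBall] with w hw using hC w hw

/-- The inclusion of the bounded holomorphic functions into `A^p`. -/
def toAp (p : ℝ≥0∞) : boundedHolomorphic n →ₗ[ℂ] Ap n p where
  toFun g := ⟨(memLp_of_mem_boundedHolomorphic p g).toLp _, g, g.2.1,
    (memLp_of_mem_boundedHolomorphic p g).coeFn_toLp⟩
  map_add' _ _ := rfl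
  map_smul' _ _ := rfl

theorem coeFn_toAp (p : ℝ≥0∞) (g : boundedHolomorphic n) :
    (toAp p g : Lp ℂ p (ballMeasure n)) =ᵐ[ballMeasure n] (g : Cn n → ℂ) :=
  (memLp_of_mem_boundedHolomorphic p g).coeFn_toLp

theorem norm_toAp_le (p : ℝ≥0∞) [Fact (1 ≤ p)] (g : boundedHolomorphic n) {C : ℝ} (hC : 0 ≤ C)
    (h : ∀ w ∈ unitBall n, ‖(g : Cn n → ℂ) w‖ ≤ C) : ‖toAp p g‖ ≤ C := by
  have h1 : ∀ᵐ w ∂(ballMeasure n), ‖(toAp p g : Lp ℂ p (ballMeasure n)) w‖ ≤ C := by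
    filter_upwards [coeFn_toAp p g, ae_mem_unitBall] with w hw hwb
    rw [hw]
    exact h w hwb
  have h2 := Lp.norm_le_of_ae_bound hC h1
  simpa [measureUnivNNReal] using h2

theorem norm_toAp_le_norm_toAp (p : ℝ≥0∞) [Fact (1 ≤ p)] (f g : boundedHolomorphic n)
    (h : ∀ w ∈ unitBall n, ‖(f : Cn n → ℂ) w‖ ≤ ‖(g : Cn n → ℂ) w‖) :
    ‖toAp p f‖ ≤ ‖toAp p g‖ := by
  have h1 : ∀ᵐ w ∂(ballMeasure n), ‖(toAp p f : Lp ℂ p (ballMeasure n)) w‖ ≤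
      ‖(toAp p g : Lp ℂ p (ballMeasure n)) w‖ := by
    filter_upwards [coeFn_toAp p f, coeFn_toAp p g, ae_mem_unitBall] with w hf hg hw
    rw [hf, hg]
    exact h w hw
  exact Lp.norm_le_norm_of_ae_le h1

/-- A series of bounded holomorphic functions that converges normally on the ball converges in
`A^p`. -/
theorem hasSum_toAp {ι : Type*} (p : ℝ≥0∞) [Fact (1 ≤ p)] {g : ι → boundedHolomorphic n}
    {f : boundedHolomorphic n} {B : ι → ℝ} (hB : Summable B)
    (hg : ∀ j, ∀ w ∈ unitBall n, ‖(g j : Cn n → ℂ) w‖ ≤ B j) (hB0 : ∀ j, 0 ≤ B j)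
    (hf : ∀ w ∈ unitBall n, HasSum (fun j => (g j : Cn n → ℂ) w) ((f : Cn n → ℂ) w)) :
    HasSum (fun j => toAp p (g j)) (toAp p f) := by
  -- The error of a partial sum is dominated pointwise, hence in `A^p` (the measure has mass one),
  -- by the tail of the majorant.
  have hle : ∀ s : Finset ι, ‖(∑ j ∈ s, toAp p (g j)) - toAp p f‖ ≤
      ∑' j, B j - ∑ j ∈ s, B j := fun s => by
    rw [← map_sum, ← map_sub]
    refine norm_toAp_le p _ (sub_nonneg.mpr (hB.sum_le_tsum s fun j _ => hB0 j)) fun w hw => ?_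
    have h1 := (hf w hw).summable.sum_add_tsum_compl (s := s)
    rw [(hf w hw).tsum_eq] at h1
    have h2 := hB.sum_add_tsum_compl (s := s)
    have h3 : ‖∑' j : ↑((s : Set ι)ᶜ), (g j : Cn n → ℂ) w‖ ≤ ∑' j : ↑((s : Set ι)ᶜ), B j :=
      tsum_of_norm_bounded (hB.subtype _).hasSum fun j => hg j w hw
    have h4 : ((∑ j ∈ s, g j - f : boundedHolomorphic n) : Cn n → ℂ) w =
        -∑' j : ↑((s : Set ι)ᶜ), (g j : Cn n → ℂ) w := by
      rw [Submodule.coe_sub, Submodule.coe_sum, Pi.sub_apply, Finset.sum_apply, ← h1]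
      ring
    rw [h4, norm_neg]
    linarith
  have hlim : Tendsto (fun s : Finset ι => ∑' j, B j - ∑ j ∈ s, B j) atTop (𝓝 0) := by
    simpa using (tendsto_const_nhds (x := ∑' j, B j)).sub hB.hasSum
  exact tendsto_iff_norm_sub_tendsto_zero.mpr
    (squeeze_zero (fun s => norm_nonneg _) hle hlim)

/-- The Bergman kernel as a bounded holomorphic function. -/
def kernelBdd (z : unitBall n) : boundedHolomorphic n :=
  ⟨kernelFun (z : Cn n), kernelFun_differentiableOn z, _, fun _ hw =>
    norm_kernelFun_le (mem_ball_zero_iff.mp z.2) (mem_ball_zero_iff.mp hw)⟩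

theorem toAp_kernelBdd (p : ℝ≥0∞) (z : unitBall n) : toAp p (kernelBdd z) = K p z := rfl

/-- The Möbius involution as a self-map of the unit ball. -/
def mobiusBall (z w : unitBall n) : unitBall n :=
  ⟨mobius z w, mem_ball_zero_iff.mpr
    (norm_mobius_lt_one (mem_ball_zero_iff.mp z.2) (mem_ball_zero_iff.mp w.2))⟩

/-- The function `K_z · (K_a ∘ φ_z)`. -/
def kernelTransform (z a : unitBall n) : boundedHolomorphic n :=
  kernelFun (a : Cn n) z • kernelBdd (mobiusBall z a)

theorem kernelTransform_apply (z a : unitBall n) {w : Cn n} (hw : w ∈ unitBall n) :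
    (kernelTransform z a : Cn n → ℂ) w = kernelFun (z : Cn n) w * kernelFun (a : Cn n) (mobius z w) :=
  (kernelFun_mul_kernelFun_mobius (mem_ball_zero_iff.mp z.2) (mem_ball_zero_iff.mp a.2)
    (mem_ball_zero_iff.mp hw)).symm

theorem norm_inner_mobius_le {z u w : Cn n} (hz : ‖z‖ < 1) (hu : ‖u‖ ≤ 1) (hw : ‖w‖ < 1) :
    ‖inner ℂ u (mobius z w)‖ ≤ 1 :=
  (norm_inner_le_norm _ _).trans (mul_le_one₀ hu (norm_nonneg _) (norm_mobius_lt_one hz hw).le)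

/-- The function `K_z · ⟨φ_z, u⟩^j`. -/
def kernelMonomial (z : unitBall n) (u : Metric.closedBall (0 : Cn n) 1) (j : ℕ) :
    boundedHolomorphic n :=
  ⟨fun w => kernelFun (z : Cn n) w * inner ℂ (u : Cn n) (mobius z w) ^ j, by
    have hz := mem_ball_zero_iff.mp z.2
    have hu := mem_closedBall_zero_iff.mp u.2
    constructor
    · exact (kernelFun_differentiableOn z).mul
        (((innerSL ℂ (u : Cn n)).differentiable.comp_differentiableOn
          (differentiableOn_mobius hz)).pow j)
    · refine ⟨((1 - ‖(z : Cn n)‖) ^ (n + 1))⁻¹, fun w hw => ?_⟩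
      have hw' := mem_ball_zero_iff.mp hw
      rw [norm_mul, norm_pow]
      exact (mul_le_of_le_one_right (norm_nonneg _) (pow_le_one₀ (norm_nonneg _)
        (norm_inner_mobius_le hz hu hw'))).trans (norm_kernelFun_le hz hw')⟩

theorem norm_kernelMonomial_apply_le (z : unitBall n) (u : Metric.closedBall (0 : Cn n) 1) (j : ℕ)
    {w : Cn n} (hw : w ∈ unitBall n) :
    ‖(kernelMonomial z u j : Cn n → ℂ) w‖ ≤ ‖kernelFun (z : Cn n) w‖ := by
  have hz := mem_ball_zero_iff.mp z.2
  have hu := mem_closedBall_zero_iff.mp u.2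
  simp only [kernelMonomial, norm_mul, norm_pow]
  exact mul_le_of_le_one_right (norm_nonneg _) (pow_le_one₀ (norm_nonneg _)
    (norm_inner_mobius_le hz hu (mem_ball_zero_iff.mp hw)))

theorem norm_toAp_kernelMonomial_le (p : ℝ≥0∞) [Fact (1 ≤ p)] (z : unitBall n)
    (u : Metric.closedBall (0 : Cn n) 1) (j : ℕ) : ‖toAp p (kernelMonomial z u j)‖ ≤ ‖K p z‖ :=
  norm_toAp_le_norm_toAp p _ (kernelBdd z) fun _ hw => norm_kernelMonomial_apply_le z u j hw

/-- The point `x u` of the unit ball. -/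
def ballSmul (u : Metric.closedBall (0 : Cn n) 1) (x : ℂ) (hx : ‖x‖ < 1) : unitBall n :=
  ⟨x • (u : Cn n), mem_ball_zero_iff.mpr (by
    rw [norm_smul]
    exact (mul_le_of_le_one_right (norm_nonneg _) (mem_closedBall_zero_iff.mp u.2)).trans_lt hx)⟩

theorem summable_choose_mul_pow (n : ℕ) {r : ℝ} (h0 : 0 ≤ r) (h1 : r < 1) :
    Summable fun j : ℕ => ((j + n).choose n : ℝ) * r ^ j :=
  (hasSum_choose_mul_geometric_of_norm_lt_one n (by rwa [Real.norm_of_nonneg h0])).summable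

/-- Binomial series of `(1 - conj x · ⟨u, φ_z(w)⟩)^{-(n+1)}`; it converges normally in `w` because
`|⟨u, φ_z(w)⟩| ≤ 1` and `K_z` is bounded. -/
theorem hasSum_kernelTransform (p : ℝ≥0∞) [Fact (1 ≤ p)] (z : unitBall n)
    (u : Metric.closedBall (0 : Cn n) 1) {x : ℂ} (hx : ‖x‖ < 1) :
    HasSum (fun j : ℕ => (((j + n).choose n : ℂ) * conj x ^ j) • toAp p (kernelMonomial z u j))
      (toAp p (kernelTransform z (ballSmul u x hx))) := by
  have hz := mem_ball_zero_iff.mp z.2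
  have hu := mem_closedBall_zero_iff.mp u.2
  simp only [← map_smul]
  have h0 : 0 < 1 - ‖(z : Cn n)‖ := by linarith
  refine hasSum_toAp p (B := fun j => ((j + n).choose n : ℝ) * ‖x‖ ^ j *
    ((1 - ‖(z : Cn n)‖) ^ (n + 1))⁻¹) ?_ ?_ (fun j => by positivity) ?_
  · exact (summable_choose_mul_pow n (norm_nonneg x) hx).mul_right _
  · intro j w hw
    rw [Submodule.coe_smul, Pi.smul_apply, norm_smul, norm_mul, norm_pow, RCLike.norm_conj,
      Complex.norm_natCast]
    gcongr
    exact (norm_kernelMonomial_apply_le z u j hw).trans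
      (norm_kernelFun_le hz (mem_ball_zero_iff.mp hw))
  · intro w hw
    rw [kernelTransform_apply z _ hw]
    have hy : ‖conj x * inner ℂ (u : Cn n) (mobius z w)‖ < 1 := by
      rw [norm_mul, RCLike.norm_conj]
      exact (mul_le_of_le_one_right (norm_nonneg _)
        (norm_inner_mobius_le hz hu (mem_ball_zero_iff.mp hw))).trans_lt hx
    have h := (hasSum_choose_mul_geometric_of_norm_lt_one n hy).mul_left (kernelFun (z : Cn n) w)
    have e : kernelFun ((ballSmul u x hx : unitBall n) : Cn n) (mobius z w) =
        1 / (1 - conj x * inner ℂ (u : Cn n) (mobius z w)) ^ (n + 1) := by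
      simp only [kernelFun, ballSmul, inner_smul_left, one_div]
    rw [e]
    refine h.congr_fun fun j => ?_
    simp only [Submodule.coe_smul, Pi.smul_apply, kernelMonomial, smul_eq_mul, mul_pow]
    ring

/-! ### Continuity of the pairing -/

section Pairing

variable {p p' : ℝ≥0∞} [Fact (1 ≤ p)] [Fact (1 ≤ p')] [p.HolderConjugate p']

/-- Complex conjugation on `L^p`. -/
def conjLp (n : ℕ) (p : ℝ≥0∞) [Fact (1 ≤ p)] :
    Lp ℂ p (ballMeasure n) →L⋆[ℂ] Lp ℂ p (ballMeasure n) :=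
  ((starL ℂ : ℂ ≃L⋆[ℂ] ℂ) : ℂ →L⋆[ℂ] ℂ).compLpL p (ballMeasure n)

theorem coeFn_conjLp (g : Lp ℂ p (ballMeasure n)) :
    conjLp n p g =ᵐ[ballMeasure n] fun w => conj (g w) :=
  ContinuousLinearMap.coeFn_compLpL _ _

variable (n p p') in
/-- The pairing as a continuous sesquilinear form on `L^p × L^{p'}`. -/
def pairingForm : Lp ℂ p (ballMeasure n) →L[ℂ] Lp ℂ p' (ballMeasure n) →L[ℂ] ℂ :=
  (ContinuousLinearMap.mul ℂ ℂ).lpPairing (ballMeasure n) p p'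

theorem pairing_eq_pairingForm (f : Ap n p) (g : Ap n p') :
    pairing f g = pairingForm n p p' (f : Lp ℂ p (ballMeasure n))
      (conjLp n p' (g : Lp ℂ p' (ballMeasure n))) := by
  rw [pairingForm, ContinuousLinearMap.lpPairing_eq_integral, pairing]
  refine integral_congr_ae ?_
  filter_upwards [coeFn_conjLp (g : Lp ℂ p' (ballMeasure n))] with w hw
  simp [hw]

theorem pairing_smul_smul (a b : ℂ) (f : Ap n p) (g : Ap n p') :
    pairing (a • f) (b • g) = a * conj b * pairing f g := by
  rw [pairing_eq_pairingForm, pairing_eq_pairingForm, Submodule.coe_smul, Submodule.coe_smul,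
    map_smul, map_smulₛₗ, map_smul, smul_apply, smul_eq_mul, smul_eq_mul]
  ring

theorem exists_norm_pairing_le (n : ℕ) (p p' : ℝ≥0∞) [Fact (1 ≤ p)] [Fact (1 ≤ p')]
    [p.HolderConjugate p'] : ∃ C : ℝ, 0 ≤ C ∧ ∀ (f : Ap n p) (g : Ap n p'),
    ‖pairing f g‖ ≤ C * ‖f‖ * ‖g‖ := by
  refine ⟨‖pairingForm n p p'‖ * ‖conjLp n p'‖, by positivity, fun f g => ?_⟩
  rw [pairing_eq_pairingForm]
  calc ‖pairingForm n p p' f (conjLp n p' g)‖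
      ≤ ‖pairingForm n p p'‖ * ‖f‖ * ‖conjLp n p' g‖ := ContinuousLinearMap.le_opNorm₂ _ _ _
    _ ≤ ‖pairingForm n p p'‖ * ‖f‖ * (‖conjLp n p'‖ * ‖g‖) := by
      gcongr
      exact (conjLp n p').le_opNorm _
    _ = _ := by ring

theorem hasSum_pairing_left {ι : Type*} {x : ι → Ap n p} {F : Ap n p} (hx : HasSum x F)
    (g : Ap n p') : HasSum (fun j => pairing (x j) g) (pairing F g) := by
  simp only [pairing_eq_pairingForm]
  exact ((((pairingForm n p p').flip (conjLp n p' g)).comp (Ap n p).subtypeL).hasSum hx)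

theorem hasSum_pairing_right {ι : Type*} {y : ι → Ap n p'} {G : Ap n p'} (hy : HasSum y G)
    (f : Ap n p) : HasSum (fun j => pairing f (y j)) (pairing f G) := by
  simp only [pairing_eq_pairingForm]
  exact (pairingForm n p p' f).hasSum ((conjLp n p').hasSum ((Ap n p').subtypeL.hasSum hy))

theorem hasSum_pairing_prod {x : ℕ → Ap n p} {y : ℕ → Ap n p'} {F : Ap n p} {G : Ap n p'}
    (hx : HasSum x F) (hy : HasSum y G) (hx' : Summable fun j => ‖x j‖)
    (hy' : Summable fun k => ‖y k‖) :
    HasSum (fun q : ℕ × ℕ => pairing (x q.1) (y q.2)) (pairing F G) := by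
  obtain ⟨C, hC, hle⟩ := exists_norm_pairing_le n p p'
  have hs : Summable fun q : ℕ × ℕ => pairing (x q.1) (y q.2) := by
    refine Summable.of_norm_bounded (g := fun q : ℕ × ℕ => C * (‖x q.1‖ * ‖y q.2‖))
      ((hx'.mul_of_nonneg hy' (fun _ => norm_nonneg _) fun _ => norm_nonneg _).mul_left C)
      fun q => (hle _ _).trans (le_of_eq (by ring))
  have h1 := hs.hasSum.prod_fiberwise fun j => hasSum_pairing_right hy (x j)
  rw [← h1.unique (hasSum_pairing_left hx G)]
  exact hs.hasSum

end Pairing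

/-! ### Approach to the boundary and hyperbolic discs -/

theorem eventually_toBoundary_iff {P : unitBall n → Prop} :
    (∀ᶠ z in toBoundary n, P z) ↔ ∃ η < (1 : ℝ), ∀ z : unitBall n, η < ‖(z : Cn n)‖ → P z := by
  rw [toBoundary, eventually_comap, eventually_iff, mem_nhdsLT_iff_exists_Ioo_subset]
  constructor
  · rintro ⟨η, hη, h⟩
    exact ⟨η, hη, fun z hz => h ⟨hz, mem_ball_zero_iff.mp z.2⟩ z rfl⟩
  · rintro ⟨η, hη, h⟩
    exact ⟨η, hη, fun x hx z hz => h z (hz ▸ hx.1)⟩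

theorem one_sub_norm_sq_pos (z : unitBall n) : 0 < 1 - ‖(z : Cn n)‖ ^ 2 := by
  have := mem_ball_zero_iff.mp z.2
  nlinarith [norm_nonneg (z : Cn n)]

theorem mobiusBall_mobiusBall (z w : unitBall n) : mobiusBall z (mobiusBall z w) = w :=
  Subtype.ext (mobius_mobius (mem_ball_zero_iff.mp z.2) (mem_ball_zero_iff.mp w.2))

theorem self_mem_D (z : unitBall n) {r : ℝ} (hr : 0 < r) : z ∈ D z r := by
  simpa [D, beta, rho, mobius_self] using hr.le

/-- The bound is `tanh r`, obtained by inverting the formula for `β`. -/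
theorem norm_mobiusBall_le_of_mem_D {z w : unitBall n} {r : ℝ} (h : w ∈ D z r) :
    ‖(mobiusBall z w : Cn n)‖ ≤ (Real.exp (2 * r) - 1) / (Real.exp (2 * r) + 1) := by
  have h1 : 1 / 2 * Real.log ((1 + ‖(mobiusBall z w : Cn n)‖) /
    (1 - ‖(mobiusBall z w : Cn n)‖)) ≤ r := h
  have hlt : ‖(mobiusBall z w : Cn n)‖ < 1 := mem_ball_zero_iff.mp (mobiusBall z w).2
  set ρ := ‖(mobiusBall z w : Cn n)‖
  have hρ : 0 ≤ ρ := norm_nonneg _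
  have h2 : Real.log ((1 + ρ) / (1 - ρ)) ≤ 2 * r := by linarith
  have h3 : 0 < 1 - ρ := by linarith
  rw [Real.log_le_iff_le_exp (by positivity), div_le_iff₀ h3] at h2
  rw [le_div_iff₀ (by positivity)]
  linarith

/-! ### The rescaled kernel of `T` and the two implications -/

section Operator

variable {p p' : ℝ≥0∞} [Fact (1 ≤ p)] [Fact (1 ≤ p')] [p.HolderConjugate p']
  (T : Ap n p →L[ℂ] Ap n p)

theorem norm_pairing_k (z : unitBall n) :
    ‖pairing (T (k p z)) (k p' z)‖ =
      (1 - ‖(z : Cn n)‖ ^ 2) ^ (n + 1) * ‖pairing (T (K p z)) (K p' z)‖ := by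
  have h0 := one_sub_norm_sq_pos z
  rw [k, k, map_smul, pairing_smul_smul, norm_mul, norm_mul, RCLike.norm_conj, Complex.norm_real,
    Real.norm_of_nonneg (by positivity), ← Real.rpow_add h0, add_halves]
  rw [← Nat.cast_add_one, Real.rpow_natCast]

theorem norm_K_two_rpow (z : unitBall n) (s : ℝ) :
    (‖K 2 z‖ ^ (2 / s))⁻¹ = (1 - ‖(z : Cn n)‖ ^ 2) ^ (((n : ℝ) + 1) / s) := by
  have h0 := one_sub_norm_sq_pos z
  have h1 : ‖K 2 z‖ ^ (2 / s) = (‖K 2 z‖ ^ 2) ^ (1 / s) := by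
    rw [← Real.rpow_natCast, ← Real.rpow_mul (norm_nonneg _)]
    congr 1
    push_cast
    ring
  rw [h1, norm_K_two_sq, Real.inv_rpow (by positivity), inv_inv, ← Real.rpow_natCast,
    ← Real.rpow_mul h0.le]
  congr 1
  push_cast
  ring

theorem norm_pairing_kNorm (z w : unitBall n) :
    ‖pairing (T (kNorm p p' z)) (kNorm p' p w)‖ =
      (1 - ‖(z : Cn n)‖ ^ 2) ^ (((n : ℝ) + 1) / p'.toReal) *
        (1 - ‖(w : Cn n)‖ ^ 2) ^ (((n : ℝ) + 1) / p.toReal) *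
          ‖pairing (T (K p z)) (K p' w)‖ := by
  have hz := one_sub_norm_sq_pos z
  have hw := one_sub_norm_sq_pos w
  rw [kNorm, kNorm, map_smul, pairing_smul_smul, norm_mul, norm_mul, RCLike.norm_conj,
    Complex.norm_real, Complex.norm_real, norm_K_two_rpow, norm_K_two_rpow,
    Real.norm_of_nonneg (by positivity), Real.norm_of_nonneg (by positivity)]

theorem norm_pairing_kernelTransform (z a b : unitBall n) :
    ‖pairing (T (toAp p (kernelTransform z a))) (toAp p' (kernelTransform z b))‖ =
      ‖kernelFun (a : Cn n) z‖ * ‖kernelFun (b : Cn n) z‖ *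
        ‖pairing (T (K p (mobiusBall z a))) (K p' (mobiusBall z b))‖ := by
  rw [kernelTransform, kernelTransform, map_smul, map_smul, map_smul, pairing_smul_smul,
    toAp_kernelBdd, toAp_kernelBdd, norm_mul, norm_mul, RCLike.norm_conj]

/-- The diagonal is the Berezin transform at `φ_z(a)`: the covariance factor `|K_a(z)|²` is absorbed
by the formula for `1 - |φ_z(a)|²`. -/
theorem norm_pairing_kernelTransform_self (z a : unitBall n) :
    (1 - ‖(z : Cn n)‖ ^ 2) ^ (n + 1) *
      ‖pairing (T (toAp p (kernelTransform z a))) (toAp p' (kernelTransform z a))‖ =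
      ((1 - ‖(a : Cn n)‖ ^ 2) ^ (n + 1))⁻¹ *
        ‖pairing (T (k p (mobiusBall z a))) (k p' (mobiusBall z a))‖ := by
  have hz := mem_ball_zero_iff.mp z.2
  have ha := mem_ball_zero_iff.mp a.2
  have ha0 := one_sub_norm_sq_pos a
  have hd : ‖1 - inner ℂ (a : Cn n) z‖ ≠ 0 := norm_ne_zero_iff.mpr (one_sub_inner_ne_zero ha hz.le)
  have hsymm : ‖1 - inner ℂ (z : Cn n) a‖ = ‖1 - inner ℂ (a : Cn n) z‖ := by
    rw [← RCLike.norm_conj]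
    simp
  have h1 : 1 - ‖(mobiusBall z a : Cn n)‖ ^ 2 = _ := one_sub_norm_sq_mobius hz ha
  rw [norm_pairing_kernelTransform, norm_pairing_k, h1, hsymm, kernelFun, norm_inv, norm_pow,
    div_pow, mul_pow, pow_right_comm _ 2]
  field_simp

variable (p') in
/-- The coefficients of the double power series of the rescaled sesquiholomorphic kernel of `T`
near the point `z` in the direction `u`. -/
def kernelCoeff (z : unitBall n) (u : Metric.closedBall (0 : Cn n) 1) (q : ℕ × ℕ) : ℂ :=
  (((1 - ‖(z : Cn n)‖ ^ 2) ^ (n + 1) : ℝ) : ℂ) *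
    (((q.1 + n).choose n : ℂ) * ((q.2 + n).choose n : ℂ) *
      pairing (T (toAp p (kernelMonomial z u q.1))) (toAp p' (kernelMonomial z u q.2)))

theorem hasSum_kernelCoeff (z : unitBall n) (u : Metric.closedBall (0 : Cn n) 1) {x y : ℂ}
    (hx : ‖x‖ < 1) (hy : ‖y‖ < 1) :
    HasSum (fun q : ℕ × ℕ => kernelCoeff p' T z u q * (conj x ^ q.1 * y ^ q.2))
      ((((1 - ‖(z : Cn n)‖ ^ 2) ^ (n + 1) : ℝ) : ℂ) *
        pairing (T (toAp p (kernelTransform z (ballSmul u x hx))))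
          (toAp p' (kernelTransform z (ballSmul u y hy)))) := by
  have hsum : ∀ (s : ℝ≥0∞) [Fact (1 ≤ s)] {x : ℂ}, ‖x‖ < 1 → Summable fun j : ℕ =>
      ‖(((j + n).choose n : ℂ) * conj x ^ j) • toAp s (kernelMonomial z u j)‖ := by
    intro s _ x hx
    refine ((summable_choose_mul_pow n (norm_nonneg x) hx).mul_right ‖K s z‖).of_nonneg_of_le
      (fun _ => norm_nonneg _) fun j => ?_
    rw [norm_smul, norm_mul, norm_pow, RCLike.norm_conj, Complex.norm_natCast]
    gcongr
    exact norm_toAp_kernelMonomial_le s z u j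
  have hsx : Summable fun j : ℕ =>
      ‖T ((((j + n).choose n : ℂ) * conj x ^ j) • toAp p (kernelMonomial z u j))‖ :=
    ((hsum p hx).mul_left ‖T‖).of_nonneg_of_le (fun _ => norm_nonneg _) fun j => T.le_opNorm _
  refine ((hasSum_pairing_prod (T.hasSum (hasSum_kernelTransform p z u hx))
    (hasSum_kernelTransform p' z u hy) hsx (hsum p' hy)).mul_left _).congr_fun fun q => ?_
  rw [kernelCoeff, map_smul, pairing_smul_smul]
  simp only [map_mul, map_pow, Complex.conj_conj, map_natCast]
  ring

theorem exists_norm_kernelCoeff_le (hp : 1 < p) (hp_top : p < ∞) (hp' : 1 < p')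
    (hp'_top : p' < ∞) : ∃ M : ℝ, 0 ≤ M ∧ ∀ (z : unitBall n) u q, ‖kernelCoeff p' T z u q‖ ≤
      M * (((q.1 + n).choose n : ℝ) * ((q.2 + n).choose n : ℝ)) := by
  obtain ⟨A, hA0, hA⟩ := exists_norm_K_le (n := n) hp hp_top
  obtain ⟨A', hA0', hA'⟩ := exists_norm_K_le (n := n) hp' hp'_top
  obtain ⟨C, hC0, hC⟩ := exists_norm_pairing_le n p p'
  -- The factor `2^(n+1)` bounds `((1-|z|²)/(1-|z|))^{n+1} = (1+|z|)^{n+1}`.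
  refine ⟨C * ‖T‖ * A * A' * 2 ^ (n + 1), by positivity, fun z u q => ?_⟩
  have hz := mem_ball_zero_iff.mp z.2
  have h0 : 0 < 1 - ‖(z : Cn n)‖ := by linarith
  have hz0 := one_sub_norm_sq_pos z
  have hconj : 1 / p.toReal + 1 / p'.toReal = 1 := by
    have hr := (ENNReal.HolderConjugate.toReal (p := p) (q := p')
      (by rw [← ENNReal.toReal_one]; exact (ENNReal.toReal_lt_toReal ENNReal.one_ne_top hp_top.ne).mpr hp))
    simpa using hr.inv_add_inv_eq_one
  set N := ((1 - ‖(z : Cn n)‖) ^ (n + 1))⁻¹ with hN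
  have hN0 : 0 < N := by positivity
  have hpair : ‖pairing (T (toAp p (kernelMonomial z u q.1)))
      (toAp p' (kernelMonomial z u q.2))‖ ≤ C * ‖T‖ * A * A' * N := by
    calc _ ≤ C * ‖T (toAp p (kernelMonomial z u q.1))‖ * ‖toAp p' (kernelMonomial z u q.2)‖ :=
          hC _ _
      _ ≤ C * (‖T‖ * (A * N ^ (1 - 1 / p.toReal))) * (A' * N ^ (1 - 1 / p'.toReal)) := by
          gcongr
          · refine (T.le_opNorm _).trans ?_
            gcongr
            exact (norm_toAp_kernelMonomial_le p z u q.1).trans (hA z)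
          · exact (norm_toAp_kernelMonomial_le p' z u q.2).trans (hA' z)
      _ = C * ‖T‖ * A * A' * (N ^ (1 - 1 / p.toReal) * N ^ (1 - 1 / p'.toReal)) := by ring
      _ = _ := by
          rw [← Real.rpow_add hN0]
          have : 1 - 1 / p.toReal + (1 - 1 / p'.toReal) = 1 := by linarith
          rw [this, Real.rpow_one]
  have hfac : (1 - ‖(z : Cn n)‖ ^ 2) ^ (n + 1) * N ≤ 2 ^ (n + 1) := by
    have : (1 - ‖(z : Cn n)‖ ^ 2) ^ (n + 1) * N = (1 + ‖(z : Cn n)‖) ^ (n + 1) := by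
      rw [hN, ← div_eq_mul_inv, ← div_pow]
      congr 1
      field_simp
      ring
    rw [this]
    gcongr
    linarith
  rw [kernelCoeff, norm_mul, norm_mul, norm_mul, Complex.norm_real, Complex.norm_natCast,
    Complex.norm_natCast, Real.norm_of_nonneg (by positivity)]
  calc _ ≤ (1 - ‖(z : Cn n)‖ ^ 2) ^ (n + 1) * (((q.1 + n).choose n : ℝ) *
        ((q.2 + n).choose n : ℝ) * (C * ‖T‖ * A * A' * N)) := by gcongr
    _ = (C * ‖T‖ * A * A') * ((1 - ‖(z : Cn n)‖ ^ 2) ^ (n + 1) * N) *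
        (((q.1 + n).choose n : ℝ) * ((q.2 + n).choose n : ℝ)) := by ring
    _ ≤ _ := by gcongr

/-- For `|a| ≤ 1/2` one has `1 - |φ_z(a)|² ≤ 4(1 - |z|²)`, so `φ_z(a)` reaches the boundary
uniformly in `a`, and the hypothesis applies there. -/
theorem eventually_norm_tsum_kernelCoeff_le
    (h : Tendsto (fun z : unitBall n => ‖pairing (T (k p z)) (k p' z)‖) (toBoundary n) (𝓝 0))
    {ε : ℝ} (hε : 0 < ε) :
    ∀ᶠ z in toBoundary n, ∀ (u : Metric.closedBall (0 : Cn n) 1) (x : ℂ), ‖x‖ ≤ 1 / 2 →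
      ‖∑' q : ℕ × ℕ, kernelCoeff p' T z u q * (conj x ^ q.1 * x ^ q.2)‖ ≤ ε := by
  obtain ⟨η, hη1, hη⟩ := eventually_toBoundary_iff.mp
    (h.eventually (gt_mem_nhds (show 0 < ε / 2 ^ (n + 1) by positivity)))
  rw [eventually_toBoundary_iff]
  -- Chosen so that `4(1-|z|²) < 1 - max(η,0)²` beyond it; the maximum is there because `η` may be
  -- negative.
  refine ⟨Real.sqrt (1 - (1 - max η 0 ^ 2) / 4), ?_, fun z hz u x hx => ?_⟩
  · rw [Real.sqrt_lt' one_pos]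
    have : max η 0 ^ 2 < 1 := by
      rw [sq_lt_one_iff₀ (le_max_right _ _)]
      exact max_lt hη1 one_pos
    linarith
  have hx1 : ‖x‖ < 1 := by linarith
  have hz1 := mem_ball_zero_iff.mp z.2
  rw [(hasSum_kernelCoeff T z u hx1 hx1).tsum_eq, norm_mul, Complex.norm_real,
    Real.norm_of_nonneg (by have := one_sub_norm_sq_pos z; positivity),
    norm_pairing_kernelTransform_self]
  set a := ballSmul u x hx1 with ha_def
  have ha1 := mem_ball_zero_iff.mp a.2
  have ha : ‖(a : Cn n)‖ ≤ 1 / 2 := by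
    refine le_trans ?_ hx
    rw [ha_def, ballSmul, norm_smul]
    exact mul_le_of_le_one_right (norm_nonneg _) (mem_closedBall_zero_iff.mp u.2)
  have hbd : η < ‖(mobiusBall z a : Cn n)‖ := by
    have h1 : 1 - ‖(mobiusBall z a : Cn n)‖ ^ 2 = _ := one_sub_norm_sq_mobius hz1 ha1
    have h2 : 1 / 2 ≤ ‖1 - inner ℂ (z : Cn n) a‖ := by
      have h4 : ‖(1 : ℂ)‖ - ‖inner ℂ (z : Cn n) (a : Cn n)‖ ≤ ‖1 - inner ℂ (z : Cn n) (a : Cn n)‖ :=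
        norm_sub_norm_le _ _
      have h5 : ‖inner ℂ (z : Cn n) (a : Cn n)‖ ≤ ‖(z : Cn n)‖ * ‖(a : Cn n)‖ :=
        norm_inner_le_norm _ _
      rw [norm_one] at h4
      nlinarith [norm_nonneg (z : Cn n), norm_nonneg (a : Cn n)]
    have h3 : 1 - ‖(mobiusBall z a : Cn n)‖ ^ 2 ≤ 4 * (1 - ‖(z : Cn n)‖ ^ 2) := by
      rw [h1, div_le_iff₀ (by positivity)]
      have hz0 := one_sub_norm_sq_pos z
      have h6 : 1 ≤ 4 * ‖1 - inner ℂ (z : Cn n) a‖ ^ 2 := by nlinarith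
      have h7 : 1 - ‖(a : Cn n)‖ ^ 2 ≤ 1 := by nlinarith [norm_nonneg (a : Cn n)]
      nlinarith
    have h4 : 1 - (1 - max η 0 ^ 2) / 4 < ‖(z : Cn n)‖ ^ 2 :=
      (Real.sqrt_lt' (by
        refine lt_of_le_of_lt (Real.sqrt_nonneg _) hz)).mp hz
    have h5 : max η 0 ^ 2 < ‖(mobiusBall z a : Cn n)‖ ^ 2 := by linarith
    exact (le_max_left η 0).trans_lt (lt_of_pow_lt_pow_left₀ 2 (norm_nonneg _) h5)
  have hB := hη _ hbd
  have hfac : ((1 - ‖(a : Cn n)‖ ^ 2) ^ (n + 1))⁻¹ ≤ 2 ^ (n + 1) := by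
    rw [← inv_pow]
    have : (1 - ‖(a : Cn n)‖ ^ 2)⁻¹ ≤ 2 := by
      rw [inv_le_comm₀ (one_sub_norm_sq_pos a) two_pos]
      nlinarith [norm_nonneg (a : Cn n)]
    have h0 := one_sub_norm_sq_pos a
    gcongr
  calc _ ≤ 2 ^ (n + 1) * (ε / 2 ^ (n + 1)) := by gcongr
    _ = ε := by field_simp

/-- The factor `0 ^ q.1`, with `0^0 = 1`, is the evaluation at `x = 0`: only the pure powers of `y`
survive. They vanish in the limit one by one, and dominated convergence passes this to the sum. -/
theorem eventually_tsum_norm_kernelCoeff_lt (hp : 1 < p) (hp_top : p < ∞) (hp' : 1 < p')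
    (hp'_top : p' < ∞)
    (h : Tendsto (fun z : unitBall n => ‖pairing (T (k p z)) (k p' z)‖) (toBoundary n) (𝓝 0))
    {t : ℝ} (ht0 : 0 ≤ t) (ht1 : t < 1) {ε : ℝ} (hε : 0 < ε) :
    ∀ᶠ z in toBoundary n, ∀ u : Metric.closedBall (0 : Cn n) 1,
      ∑' q : ℕ × ℕ, ‖kernelCoeff p' T z u q‖ * (0 ^ q.1 * t ^ q.2) < ε := by
  obtain ⟨M, hM0, hM⟩ := exists_norm_kernelCoeff_le (n := n) T hp hp_top hp' hp'_top
  -- The filter lives on pairs `(z, u)` and is pulled back along the first projection, which encodes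
  -- uniformity in `u`.
  have hcoeff : ∀ m : ℕ, Tendsto (fun i : unitBall n × Metric.closedBall (0 : Cn n) 1 =>
      ‖kernelCoeff p' T i.1 i.2 (0, m)‖) (comap Prod.fst (toBoundary n)) (𝓝 0) := by
    refine tendsto_coeff_zero (R := 1 / 2) (by norm_num)
      (b := fun q => M * (((q.1 + n).choose n : ℝ) * ((q.2 + n).choose n : ℝ))) ?_
      (fun i q => hM i.1 i.2 q) ?_
    · have h1 := summable_choose_mul_pow n (r := 1 / 2) (by norm_num) (by norm_num)
      refine ((h1.mul_of_nonneg h1 (fun _ => by positivity)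
        (fun _ => by positivity)).mul_left M).congr fun q => ?_
      rw [pow_add]
      ring
    · intro δ hδ
      rw [eventually_comap]
      filter_upwards [eventually_norm_tsum_kernelCoeff_le T h hδ] with z hz
      rintro ⟨_, u⟩ rfl x hx
      exact hz u x hx
  have hlim : Tendsto (fun i : unitBall n × Metric.closedBall (0 : Cn n) 1 =>
      ∑' q : ℕ × ℕ, ‖kernelCoeff p' T i.1 i.2 q‖ * (0 ^ q.1 * t ^ q.2))
      (comap Prod.fst (toBoundary n)) (𝓝 (∑' _ : ℕ × ℕ, (0 : ℝ))) := by
    refine tendsto_tsum_of_dominated_convergence (bound := fun q : ℕ × ℕ =>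
      M * ((((q.1 + n).choose n : ℝ) * 0 ^ q.1) * (((q.2 + n).choose n : ℝ) * t ^ q.2))) ?_ ?_ ?_
    · exact ((summable_choose_mul_pow n le_rfl one_pos).mul_of_nonneg
        (summable_choose_mul_pow n ht0 ht1) (fun _ => by positivity)
        (fun _ => by positivity)).mul_left M
    · rintro ⟨j, m⟩
      rcases Nat.eq_zero_or_pos j with rfl | hj
      · simpa using (hcoeff m).mul_const (t ^ m)
      · simpa [hj.ne'] using tendsto_const_nhds
    · refine Eventually.of_forall fun i q => ?_
      rw [Real.norm_of_nonneg (by positivity)]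
      calc _ ≤ M * (((q.1 + n).choose n : ℝ) * ((q.2 + n).choose n : ℝ)) * (0 ^ q.1 * t ^ q.2) := by
            gcongr
            exact hM i.1 i.2 q
        _ = _ := by ring
  rw [tsum_zero] at hlim
  have := hlim.eventually (gt_mem_nhds hε)
  rw [eventually_comap] at this
  filter_upwards [this] with z hz u using hz (z, u) rfl

/-- At `x = 0` the first transformed kernel is `K_z` itself. The weight at `w = φ_z(b)` is `1-|w|² =
(1-|z|²)ρ` with `ρ ≤ (1-t)^{-2}`, so conjugacy of the exponents restores the power `(1-|z|²)^{n+1}`;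
`2^{n+1}` bounds `1/|K_b(z)|`. -/
theorem norm_pairing_kNorm_le (hconj : 1 / p.toReal + 1 / p'.toReal = 1) (z : unitBall n)
    (u : Metric.closedBall (0 : Cn n) 1) {t : ℝ} (ht0 : 0 ≤ t) (ht1 : t < 1)
    (ht : ‖(t : ℂ)‖ < 1)
    (hs : Summable fun q : ℕ × ℕ => ‖kernelCoeff p' T z u q‖ * (0 ^ q.1 * t ^ q.2)) :
    ‖pairing (T (kNorm p p' z)) (kNorm p' p (mobiusBall z (ballSmul u t ht)))‖ ≤
      (((1 - t) ^ 2)⁻¹) ^ (((n : ℝ) + 1) / p.toReal) * 2 ^ (n + 1) *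
        ∑' q : ℕ × ℕ, ‖kernelCoeff p' T z u q‖ * (0 ^ q.1 * t ^ q.2) := by
  have hz1 := mem_ball_zero_iff.mp z.2
  have hz0 := one_sub_norm_sq_pos z
  have h00 : ‖(0 : ℂ)‖ < 1 := by simp
  have hser := hasSum_kernelCoeff (p' := p') T z u h00 ht
  set b := ballSmul u t ht with hb_def
  have hb1 := mem_ball_zero_iff.mp b.2
  have hb0 := one_sub_norm_sq_pos b
  have hbt : ‖(b : Cn n)‖ ≤ t := by
    rw [hb_def, ballSmul, norm_smul, Complex.norm_real, Real.norm_of_nonneg ht0]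
    exact mul_le_of_le_one_right ht0 (mem_closedBall_zero_iff.mp u.2)
  have hzero : ((ballSmul u 0 h00 : unitBall n) : Cn n) = 0 := by simp [ballSmul]
  have hmz : mobiusBall z (ballSmul u 0 h00) = z := by
    refine Subtype.ext ?_
    simp only [mobiusBall, hzero, mobius_zero]
  have hk0 : kernelFun ((ballSmul u 0 h00 : unitBall n) : Cn n) z = 1 := by
    simp [hzero, kernelFun]
  set X := ‖pairing (T (K p z)) (K p' (mobiusBall z b))‖ with hX
  have hX0 : 0 ≤ X := norm_nonneg _
  have hle : (1 - ‖(z : Cn n)‖ ^ 2) ^ (n + 1) * (‖kernelFun (b : Cn n) z‖ * X) ≤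
      ∑' q : ℕ × ℕ, ‖kernelCoeff p' T z u q‖ * (0 ^ q.1 * t ^ q.2) := by
    have h1 := hser.norm_le_of_bounded hs.hasSum fun q => by
      rw [norm_mul, norm_mul, norm_pow, norm_pow, RCLike.norm_conj, norm_zero, Complex.norm_real,
        Real.norm_of_nonneg ht0]
    rwa [norm_mul, norm_pairing_kernelTransform, hmz, hk0, norm_one, one_mul, Complex.norm_real,
      Real.norm_of_nonneg (by positivity)] at h1
  have hsymm : ‖1 - inner ℂ (b : Cn n) z‖ = ‖1 - inner ℂ (z : Cn n) b‖ := by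
    rw [← RCLike.norm_conj]
    simp
  have hd : 0 < ‖1 - inner ℂ (z : Cn n) b‖ :=
    norm_pos_iff.mpr (one_sub_inner_ne_zero hz1 hb1.le)
  have hdlow : 1 - t ≤ ‖1 - inner ℂ (z : Cn n) b‖ := by
    have := one_sub_norm_le_norm_one_sub_inner (b : Cn n) hz1
    rw [hsymm] at this
    linarith
  have hdup : ‖1 - inner ℂ (b : Cn n) z‖ ≤ 2 := by
    have h4 : ‖inner ℂ (b : Cn n) (z : Cn n)‖ ≤ ‖(b : Cn n)‖ * ‖(z : Cn n)‖ :=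
      norm_inner_le_norm _ _
    have h5 := norm_sub_le (1 : ℂ) (inner ℂ (b : Cn n) z)
    rw [norm_one] at h5
    nlinarith [norm_nonneg (z : Cn n), norm_nonneg (b : Cn n)]
  have hXle : X ≤ 2 ^ (n + 1) * (‖kernelFun (b : Cn n) z‖ * X) := by
    have : 1 ≤ 2 ^ (n + 1) * ‖kernelFun (b : Cn n) z‖ := by
      rw [kernelFun, norm_inv, norm_pow, ← div_eq_mul_inv, ← div_pow]
      refine one_le_pow₀ ?_
      rwa [one_le_div (by rwa [hsymm])]
    nlinarith
  set ρ := (1 - ‖(b : Cn n)‖ ^ 2) / ‖1 - inner ℂ (z : Cn n) b‖ ^ 2 with hρ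
  have hρ0 : 0 < ρ := by positivity
  have hρle : ρ ≤ ((1 - t) ^ 2)⁻¹ := by
    rw [hρ, div_eq_mul_inv]
    have h6 : 1 - ‖(b : Cn n)‖ ^ 2 ≤ 1 := by nlinarith [norm_nonneg (b : Cn n)]
    have h7 : 0 < 1 - t := by linarith
    refine (mul_le_of_le_one_left (by positivity) h6).trans ?_
    gcongr
  have h1 : 1 - ‖(mobiusBall z b : Cn n)‖ ^ 2 = (1 - ‖(z : Cn n)‖ ^ 2) * ρ :=
    (one_sub_norm_sq_mobius hz1 hb1).trans (mul_div_assoc _ _ _)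
  have hpow : (1 - ‖(z : Cn n)‖ ^ 2) ^ (((n : ℝ) + 1) / p'.toReal) *
      (1 - ‖(z : Cn n)‖ ^ 2) ^ (((n : ℝ) + 1) / p.toReal) = (1 - ‖(z : Cn n)‖ ^ 2) ^ (n + 1) := by
    rw [← Real.rpow_add hz0, ← Real.rpow_natCast _ (n + 1)]
    congr 1
    push_cast
    linear_combination ((n : ℝ) + 1) * hconj
  rw [norm_pairing_kNorm, h1, Real.mul_rpow hz0.le hρ0.le, ← mul_assoc, hpow, ← hX]
  calc (1 - ‖(z : Cn n)‖ ^ 2) ^ (n + 1) * ρ ^ (((n : ℝ) + 1) / p.toReal) * X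
      ≤ (1 - ‖(z : Cn n)‖ ^ 2) ^ (n + 1) * (((1 - t) ^ 2)⁻¹) ^ (((n : ℝ) + 1) / p.toReal) *
        (2 ^ (n + 1) * (‖kernelFun (b : Cn n) z‖ * X)) := by gcongr
    _ = (((1 - t) ^ 2)⁻¹) ^ (((n : ℝ) + 1) / p.toReal) * 2 ^ (n + 1) *
        ((1 - ‖(z : Cn n)‖ ^ 2) ^ (n + 1) * (‖kernelFun (b : Cn n) z‖ * X)) := by ring
    _ ≤ _ := by gcongr

theorem vanishesOnDiscs_of_tendsto (hp : 1 < p) (hp_top : p < ∞) (hp' : 1 < p')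
    (hp'_top : p' < ∞) (hconj : 1 / p.toReal + 1 / p'.toReal = 1)
    (h : Tendsto (fun z : unitBall n => ‖pairing (T (k p z)) (k p' z)‖) (toBoundary n) (𝓝 0))
    {r : ℝ} (hr : 0 < r) : VanishesOnDiscs p' T r := by
  set t := (Real.exp (2 * r) - 1) / (Real.exp (2 * r) + 1) with ht_def
  have hexp : 1 < Real.exp (2 * r) := Real.one_lt_exp_iff.mpr (by linarith)
  have ht0 : 0 < t := div_pos (by linarith) (by linarith)
  have ht1 : t < 1 := by rw [ht_def, div_lt_one (by linarith)]; linarith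
  have ht : ‖(t : ℂ)‖ < 1 := by rwa [Complex.norm_real, Real.norm_of_nonneg ht0.le]
  obtain ⟨M, hM0, hM⟩ := exists_norm_kernelCoeff_le (n := n) T hp hp_top hp' hp'_top
  set κ : ℝ := (((1 - t) ^ 2)⁻¹) ^ (((n : ℝ) + 1) / p.toReal) * 2 ^ (n + 1) with hκ
  have hκ0 : 0 < κ := by
    have : 0 < 1 - t := by linarith
    positivity
  rw [VanishesOnDiscs, ENNReal.tendsto_nhds_zero]
  intro ε hε
  obtain ⟨δ, hδ0, hδε⟩ := ENNReal.lt_iff_exists_nnreal_btwn.mp hε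
  have hδ : (0 : ℝ) < δ := by exact_mod_cast hδ0
  filter_upwards [eventually_tsum_norm_kernelCoeff_lt T hp hp_top hp' hp'_top h ht0.le ht1
    (div_pos hδ hκ0)] with z hz
  refine iSup₂_le fun w hw => le_trans ?_ hδε.le
  have hwt := norm_mobiusBall_le_of_mem_D hw
  rw [← ht_def] at hwt
  -- Dividing `φ_z(w)` by the fixed radius `t = tanh r` writes every `w` in the disc as `φ_z(tu)`.
  -- Directions of norm below 1 occur, which is why `u` ranges over the closed ball and not the
  -- sphere.
  set u : Metric.closedBall (0 : Cn n) 1 := ⟨((t⁻¹ : ℝ) : ℂ) • (mobiusBall z w : Cn n), by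
    rw [mem_closedBall_zero_iff, norm_smul, Complex.norm_real, Real.norm_of_nonneg (by positivity),
      inv_mul_le_iff₀ ht0, mul_one]
    exact hwt⟩ with hu
  have hb : ballSmul u t ht = mobiusBall z w := by
    refine Subtype.ext ?_
    simp only [ballSmul, hu, smul_smul, ← Complex.ofReal_mul, mul_inv_cancel₀ ht0.ne',
      Complex.ofReal_one, one_smul]
  have hs : Summable fun q : ℕ × ℕ => ‖kernelCoeff p' T z u q‖ * (0 ^ q.1 * t ^ q.2) := by
    refine (((summable_choose_mul_pow n le_rfl one_pos).mul_of_nonneg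
        (summable_choose_mul_pow n ht0.le ht1) (fun _ => by positivity)
        (fun _ => by positivity)).mul_left M).of_nonneg_of_le (fun _ => by positivity) fun q => ?_
    calc _ ≤ M * (((q.1 + n).choose n : ℝ) * ((q.2 + n).choose n : ℝ)) * (0 ^ q.1 * t ^ q.2) := by
            gcongr
            exact hM z u q
      _ = _ := by ring
  have hle := norm_pairing_kNorm_le T hconj z u ht0.le ht1 ht hs
  rw [hb, mobiusBall_mobiusBall, ← hκ] at hle
  have hfin : ‖pairing (T (kNorm p p' z)) (kNorm p' p w)‖ ≤ δ := by
    refine hle.trans ?_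
    have := (lt_div_iff₀' hκ0).mp (hz u)
    exact this.le
  rw [← ofReal_norm]
  exact ENNReal.ofReal_le_of_le_toReal (by simpa using hfin)

/-- Take `w = z` in the supremum: the two normalizing weights at `z` multiply to `(1-|z|²)^{n+1}`.
-/
theorem tendsto_of_vanishesOnDiscs (hconj : 1 / p.toReal + 1 / p'.toReal = 1) {r : ℝ} (hr : 0 < r)
    (h : VanishesOnDiscs p' T r) :
    Tendsto (fun z : unitBall n => ‖pairing (T (k p z)) (k p' z)‖) (toBoundary n) (𝓝 0) := by
  have heq : ∀ z : unitBall n, ‖pairing (T (k p z)) (k p' z)‖ =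
      ‖pairing (T (kNorm p p' z)) (kNorm p' p z)‖ := fun z => by
    rw [norm_pairing_k, norm_pairing_kNorm, ← Real.rpow_add (one_sub_norm_sq_pos z),
      ← Real.rpow_natCast]
    congr 2
    push_cast
    linear_combination -((n : ℝ) + 1) * hconj
  have h1 : Tendsto (fun z : unitBall n => ‖pairing (T (kNorm p p' z)) (kNorm p' p z)‖ₑ)
      (toBoundary n) (𝓝 0) :=
    tendsto_of_tendsto_of_tendsto_of_le_of_le tendsto_const_nhds h (fun _ => zero_le)
      fun z => le_iSup₂ (f := fun w (_ : w ∈ D z r) =>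
        ‖pairing (T (kNorm p p' z)) (kNorm p' p w)‖ₑ) z (self_mem_D z hr)
  have h2 := (ENNReal.tendsto_toReal ENNReal.zero_ne_top).comp h1
  simpa only [Function.comp_def, toReal_enorm, ENNReal.toReal_zero, ← heq] using h2

end Operator

end Bergman

end

theorem proposition2p7 (n : ℕ) (hn : 1 ≤ n) (p p' : ℝ≥0∞) [Fact (1 ≤ p)] (hp : 1 < p)
    (hp_top : p < ∞) (hpp' : 1 / p + 1 / p' = 1) (T : Bergman.Ap n p →L[ℂ] Bergman.Ap n p) :
    List.TFAE [
      ∀ r : ℝ, 0 < r → Bergman.VanishesOnDiscs p' T r,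
      ∃ r : ℝ, 0 < r ∧ Bergman.VanishesOnDiscs p' T r,
      Tendsto (fun z : Bergman.unitBall n =>
          ‖Bergman.pairing (T (Bergman.k p z)) (Bergman.k p' z)‖)
        (Bergman.toBoundary n) (𝓝 0)] := by
  have hconj : p.HolderConjugate p' := by
    rw [ENNReal.holderConjugate_iff]
    simpa using hpp'
  have hq : 1 < p.toReal := by
    rw [← ENNReal.toReal_one]
    exact (ENNReal.toReal_lt_toReal ENNReal.one_ne_top hp_top.ne).mpr hp
  have hreal := ENNReal.HolderConjugate.toReal (p := p) (q := p') hq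
  have hp'0 : 0 < p'.toReal := hreal.symm.pos
  have hp'_top : p' < ∞ := (ENNReal.toReal_pos_iff.mp hp'0).2
  have hp' : 1 < p' := by
    have := hreal.symm.lt
    rw [← ENNReal.toReal_one] at this
    exact (ENNReal.toReal_lt_toReal ENNReal.one_ne_top hp'_top.ne).mp this
  have : Fact (1 ≤ p') := ⟨hp'.le⟩
  have hc : 1 / p.toReal + 1 / p'.toReal = 1 := by simpa using hreal.inv_add_inv_eq_one
  tfae_have 1 → 2 := fun h => ⟨1, one_pos, h 1 one_pos⟩
  tfae_have 2 → 3 := fun ⟨_, hr, h⟩ => Bergman.tendsto_of_vanishesOnDiscs T hc hr h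
  tfae_have 3 → 1 := fun h _ hr =>
    Bergman.vanishesOnDiscs_of_tendsto T hp hp_top hp' hp'_top hc h hr
  tfae_finish
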